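/- **Setting.** Logarithms are to base $2$ and $H$, $S$, $I$ denote Shannon entropy, von Neumann entropy and (classical or quantum) mutual information. For integers $1<k<n$ put $m:=n-k$. For a $k$-subset $S$ of $[n]$ let $|\psi_S\rangle:=k^{-1/2}\sum_{i\in S}|i\rangle$, and for $t\ge 0$ let $$\rho_t^{AB}:=\binom nk^{-1}\sum_{|S|=k}|S\rangle\langle S|^A\otimes\big(|\psi_S\rangle\langle\psi_S|^{\otimes t}\big)^B ,$$ with reduced state $\rho^B_t$; $S(B)_t$ and $I(A:B)_t$ refer to this state. A *learner* with $t$ samples is a quantum measurement (POVM) of $B$ whose outcome $F$ is a $k$-subset of $[n]$. Its success probability is $\Pr[F=A]$ for the uniformly random set $A$, and $I(A:F)$ is its output information. For $\delta\in(0,1/4]$ and an integer $T\ge 0$ we say that the *information argument yields the bound $T$ for error $\delta$* if there is a real $\beta$ such that $I(A:F)\ge\beta$ for every learner, with any number of samples, of success probability at least $1-\delta$, and $I(A:B)_t<\beta$ for all $t<T$. **Theorem.** 1. Let $2\le m\le n/10$, $\kappa\in(0,n/m)$, and suppose that $t:=\kappa n$ is an integer. Then $$\log\binom nm=H(A)\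 \ge\ I(A:B)_t=S(B)_t\ \ge\ \Big(1-e^{-\kappa}-\frac{\kappa m}{n}\Big)\log\binom nm-1 .$$ 2. For every $\varepsilon>0$ there is $\kappa_0>0$ such that for every $\kappa\ge\kappa_0$ there are $\eta>0$ and $n_0$ with $I(A:B)_t\ge(1-\varepsilon)\log\binom nm$ for $t=\lceil\kappa n\rceil$ and all $n\ge n_0$, $2\le m\le\eta n$. 3. Let $c>0$, $\delta\in(0,1/4]$, $1<k<n$, and let $\mathscr A'$ be a learner with $t'$ samples and success probability exactly $1-\delta$. Then there is a learner $\mathscr A$ with $t'+\lceil ck\rceil$ samples that, for every $S$, outputs $S$ on samples of $S$ with at least the probability with which $\mathscr A'$ does (so that its success probability is at least $1-\delta$), and whose output $F$ satisfies $I(A:F)\le(1-c_0\delta)H(A)$ with $c_0:=1-e^{-2c}>0$. 4. There are constants $\gamma>7/8$, $c>0$ and $n_0$ such that for all $n\ge n_0$, with $m=\lfloor\sqrt n\rfloor$ and $k=n-m$: for $t=\lfloor n/2\rfloor+\lceil ck\rceil$ one has $I(A:B)_t\ge\gamma\log\binom nm$; and for every $t'\ge 0$ and every learner $\mathscr A'$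 with $t'$ samples and success probability exactly $3/4$ there is a learner $\mathscr A$ with $t'+\lceil ck\rceil$ samples that for every $S$ outputs $S$ on samples of $S$ with at least the probability with which $\mathscr A'$ does (hence has success probability at least $3/4$), and whose output satisfies $I(A:F)\le\frac78\log\binom nm$. 5. For every $\delta\in(0,1/4]$ there are constants $\kappa,\eta>0$ and $n_0$ such that for all $n\ge n_0$ and $2\le m\le\eta n$, every bound $T$ that the information argument yields for error $\delta$ satisfies $T\le\kappa n$. 6. For all $\kappa,p>0$ there is $M$ such that for all $n,k,t$ with $\min\{k,n-k\}\ge M$ and $t\le\kappa k$, every learner with $t$ samples has success probability at most $p$. In particular, for every $\varepsilon>0$ there is $\kappa_0>0$ such that for every $\kappa\ge\kappa_0$ there are $\eta>0$ and $M$ such that for all $M\le m\le\eta n$ and $t=\lceil\kappa n\rceil$, the uniform ensemble of the pure states $|\psi_S\rangle^{\otimes t}$, $|S|=n-m$, has entropy $S(B)_t\ge(1-\varepsilon)H(A)$, while every measurement identifies the state with probability at most $\varepsilon$. -/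

import Mathlib

open scoped Kronecker ComplexOrder

noncomputable section

namespace CouponCollector

/-! ### Entropy and mutual information (logarithms to base 2) -/

/-- Shannon entropy `∑ p(x) log (1 / p(x))` of a distribution on a finite set
(a point with `p(x) = 0` contributes `0`). -/
def shannonEntropy {X : Type*} [Fintype X] (p : X → ℝ) : ℝ :=
  ∑ x, p x * Real.logb 2 (1 / p x)

/-- Mutual information `H(X) + H(Y) - H(XY)` of a joint distribution on a finite product. -/
def mutualInfo {X Y : Type*} [Fintype X] [Fintype Y] (p : X × Y → ℝ) : ℝ :=
  shannonEntropy (fun x => ∑ y, p (x, y)) + shannonEntropy (fun y => ∑ x, p (x, y))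
    - shannonEntropy p

/-- Von Neumann entropy `-Tr (ρ log ρ)`; the logarithm is taken by functional calculus of the
Hermitian matrix `ρ`, with `log 0 = 0`. -/
def vnEntropy {ι : Type*} [Fintype ι] [DecidableEq ι] (ρ : Matrix ι ι ℂ) : ℝ :=
  -(Matrix.trace (ρ * cfc (Real.logb 2) ρ)).re

/-- The state of the first register: the second one is traced out. -/
def marginalFst {α β : Type*} [Fintype β] (ρ : Matrix (α × β) (α × β) ℂ) : Matrix α α ℂ :=
  Matrix.of fun i j => ∑ b, ρ (i, b) (j, b)

/-- The state of the second register: the first one is traced out. -/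
def marginalSnd {α β : Type*} [Fintype α] (ρ : Matrix (α × β) (α × β) ℂ) : Matrix β β ℂ :=
  Matrix.of fun i j => ∑ a, ρ (a, i) (a, j)

/-- Quantum mutual information `S(A) + S(B) - S(AB)` of a bipartite state. -/
def qMutualInfo {α β : Type*} [Fintype α] [DecidableEq α] [Fintype β] [DecidableEq β]
    (ρ : Matrix (α × β) (α × β) ℂ) : ℝ :=
  vnEntropy (marginalFst ρ) + vnEntropy (marginalSnd ρ) - vnEntropy ρ

/-! ### Quantum coupon collection -/

/-- The `k`-element subsets of an `n`-element set. -/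
abbrev KSet (n k : ℕ) : Type := {S : Finset (Fin n) // S.card = k}

/-- The uniform distribution of the unknown set. -/
def uniformSet (n k : ℕ) : KSet n k → ℝ := fun _ => 1 / (n.choose k : ℝ)

/-- The quantum sample `|ψ_S⟩ = k^{-1/2} ∑_{i ∈ S} |i⟩`. -/
def sample {n k : ℕ} (S : KSet n k) : Fin n → ℂ :=
  fun i => if i ∈ S.1 then ((1 / Real.sqrt k : ℝ) : ℂ) else 0

/-- The product vector `|ψ_S⟩^{⊗ t}`; the basis of `(ℂ^n)^{⊗ t}` is indexed by `Fin t → Fin n`. -/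
def samples {n k : ℕ} (t : ℕ) (S : KSet n k) : (Fin t → Fin n) → ℂ :=
  fun u => ∏ j, sample S (u j)

/-- The density matrix `|ψ_S⟩⟨ψ_S|^{⊗ t}`. -/
def samplesState {n k : ℕ} (t : ℕ) (S : KSet n k) :
    Matrix (Fin t → Fin n) (Fin t → Fin n) ℂ :=
  Matrix.vecMulVec (samples t S) (star (samples t S))

/-- The classical-quantum state `ρ^{AB}` on the register `A` of the uniformly random set and the
register `B` of the `t` quantum samples. -/
def stateAB (n k t : ℕ) :
    Matrix (KSet n k × (Fin t → Fin n)) (KSet n k × (Fin t → Fin n)) ℂ :=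
  (1 / (n.choose k : ℂ)) • ∑ S : KSet n k, (Matrix.single S S (1 : ℂ)) ⊗ₖ samplesState t S

/-- The average state `ρ^B` of the samples. -/
def stateB (n k t : ℕ) : Matrix (Fin t → Fin n) (Fin t → Fin n) ℂ :=
  marginalSnd (stateAB n k t)

/-- A learner that is given `t` quantum samples and outputs a `k`-subset: a general quantum
measurement (POVM) of the samples whose outcomes are the `k`-subsets. -/
structure Learner (n k t : ℕ) where
  effect : KSet n k → Matrix (Fin t → Fin n) (Fin t → Fin n) ℂ
  posSemidef : ∀ F, (effect F).PosSemidef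
  sum_eq_one : ∑ F, effect F = 1

namespace Learner

variable {n k t : ℕ}

/-- The probability that the output is `F` on samples of `S`. -/
def outputProb (L : Learner n k t) (S F : KSet n k) : ℝ :=
  (Matrix.trace (L.effect F * samplesState t S)).re

/-- The joint distribution of the uniformly random set `A` and the output `F`. -/
def jointProb (L : Learner n k t) : KSet n k × KSet n k → ℝ :=
  fun x => uniformSet n k x.1 * L.outputProb x.1 x.2

/-- The probability that the output equals the uniformly random set. -/
def successProb (L : Learner n k t) : ℝ := ∑ S, L.jointProb (S, S)

/-- The mutual information `I(A : F)` between the random set and the output. -/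
def outputInfo (L : Learner n k t) : ℝ := mutualInfo L.jointProb

end Learner

/-- The information-theoretic argument yields the lower bound `T` on the number of samples for
error `δ`: for some `β`, success probability at least `1 - δ` alone (with any number of samples)
forces `I(A : F) ≥ β`, while `I(A : B) < β` as long as there are fewer than `T` samples. -/
def InfoArgumentYields (n k : ℕ) (δ : ℝ) (T : ℕ) : Prop :=
  ∃ β : ℝ,
    (∀ (t : ℕ) (L : Learner n k t), 1 - δ ≤ L.successProb → β ≤ L.outputInfo) ∧
    ∀ t < T, qMutualInfo (stateAB n k t) < β

end CouponCollector

end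

noncomputable section

namespace CouponCollector

/-! Holevo information. The sample states are pure, so S(AB) = S(A) and I(A:B) = S(B), which is the
entropy of the Gram matrix with entries (|S ∩ T|/k)^t / C(n,k). If x elements are missing from both
S and T, this power is ((k-m+x)/k)^t, the mixture of the kernels C(x,j)/C(m,j) in which j is the
number of distinct coupons, among m of k, seen in t draws. By concavity of entropy it remains to
treat one j. That matrix counts the j-sets disjoint from S and T, hence is M M*, and it has the
entropy of M* M, a matrix on j-sets. Vandermonde's identity turns the latter into a hypergeometric
mixture of `supersetState`s with index i close to j, and these have purity at most 2^(j-i)/C(n,i).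
As log C(n,i) ≥ (i/m) log C(n,m), each j contributes nearly (j/m) log C(n,m), and the mean of j is
m(1-(1-1/k)^t): this is `vnEntropy_stateB_ge`.

Output information. `Learner.verify` projects ck further samples onto the state of the proposed set
and outputs a uniformly random set if this fails. A correct proposal always passes, a wrong one with
probability at most e^(-2c). So a fraction (1-e^(-2c))δ of the outputs is pure noise, and the
information drops by that fraction (`mutualInfo_le_of_erasure`). Since the Holevo information of κn
samples eventually exceeds this level, the information argument stops at O(n) samples
(`infoArgument_bound`).

Indistinguishability. Sets that take one element from each of L pairs, plus fixed elements, form a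
cube on which one flip has overlap ω = (1-1/k)^t and two flips at most ω². Fourier analysis on the
cube bounds the success probability by 8/(Lω²) (`sum_quadForm_cube_le`). The symmetry of the
ensemble carries the bound over to uniformly random sets, and ω stays bounded below when t = O(k).
-/

/-! ### Von Neumann entropy: spectral form, concavity, purity and dimension bounds. -/

lemma _root_.Matrix.IsHermitian.trace_cfc {ι : Type*} [Fintype ι] [DecidableEq ι]
    {ρ : Matrix ι ι ℂ} (h : ρ.IsHermitian) (f : ℝ → ℝ) :
    Matrix.trace (cfc f ρ) = ((∑ i, f (h.eigenvalues i) : ℝ) : ℂ) := by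
  rw [h.cfc_eq, Matrix.IsHermitian.cfc, Unitary.conjStarAlgAut_apply, Matrix.trace_mul_comm,
    ← mul_assoc]
  simp [Matrix.trace]

lemma vnEntropy_eq_sum {ι : Type*} [Fintype ι] [DecidableEq ι]
    {ρ : Matrix ι ι ℂ} (h : ρ.IsHermitian) :
    vnEntropy ρ = (∑ i, Real.negMulLog (h.eigenvalues i)) / Real.log 2 := by
  -- On a finite spectrum every function is continuous, so the discontinuity of the logarithm at 0
  -- does no harm.
  have hc : ∀ f : ℝ → ℝ, ContinuousOn f (spectrum ℝ ρ) := fun f =>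
    (Matrix.finite_real_spectrum).continuousOn f
  have h1 : ρ * cfc (Real.logb 2) ρ = cfc (fun x => x * Real.logb 2 x) ρ := by
    conv_lhs => rw [← cfc_id ℝ ρ h.isSelfAdjoint]
    rw [cfc_id ℝ ρ h.isSelfAdjoint]
    rw [cfc_mul _ _ _ (hc _) (hc _), cfc_id' ℝ ρ h.isSelfAdjoint]
  rw [vnEntropy, h1, h.trace_cfc, Complex.ofReal_re, Finset.sum_div, ← Finset.sum_neg_distrib]
  refine Finset.sum_congr rfl fun i _ => ?_
  simp only [Real.negMulLog, Real.logb]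
  ring

/-- On both spectra the logarithm agrees with one interpolating polynomial `p`, and polynomials
satisfy A* p(AA*) = p(A*A) A*. Cyclicity of the trace then gives the equality without matching
eigenvalues. -/
lemma vnEntropy_mul_conjTranspose_comm {ι κ : Type*} [Fintype ι] [DecidableEq ι] [Fintype κ]
    [DecidableEq κ] (A : Matrix ι κ ℂ) :
    vnEntropy (A * A.conjTranspose) = vnEntropy (A.conjTranspose * A) := by
  have h1 : (A * A.conjTranspose).IsHermitian := Matrix.isHermitian_mul_conjTranspose_self A
  have h2 : (A.conjTranspose * A).IsHermitian := Matrix.isHermitian_conjTranspose_mul_self A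
  set s : Finset ℝ := (Matrix.finite_real_spectrum (A := A * A.conjTranspose)).toFinset ∪
    (Matrix.finite_real_spectrum (A := A.conjTranspose * A)).toFinset with hs
  set p := Lagrange.interpolate s id (Real.logb 2) with hp
  have key : ∀ x ∈ s, Real.logb 2 x = p.eval x := fun x hx =>
    (Lagrange.eval_interpolate_at_node (v := id) _ (Set.injOn_id _) hx).symm
  have e1 : cfc (Real.logb 2) (A * A.conjTranspose) = Polynomial.aeval (A * A.conjTranspose) p := by
    rw [← cfc_polynomial p _ h1.isSelfAdjoint]
    exact cfc_congr fun x hx => key x (by simp [hs, hx])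
  have e2 : cfc (Real.logb 2) (A.conjTranspose * A) = Polynomial.aeval (A.conjTranspose * A) p := by
    rw [← cfc_polynomial p _ h2.isSelfAdjoint]
    exact cfc_congr fun x hx => key x (by simp [hs, hx])
  have comm : ∀ n : ℕ, A.conjTranspose * (A * A.conjTranspose) ^ n
      = (A.conjTranspose * A) ^ n * A.conjTranspose := by
    intro n
    induction n with
    | zero => simp
    | succ n ih => rw [pow_succ, ← Matrix.mul_assoc, ih, pow_succ]; simp only [Matrix.mul_assoc]
  have comm' : A.conjTranspose * Polynomial.aeval (A * A.conjTranspose) p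
      = Polynomial.aeval (A.conjTranspose * A) p * A.conjTranspose := by
    rw [Polynomial.aeval_eq_sum_range, Polynomial.aeval_eq_sum_range, Matrix.mul_sum, Matrix.sum_mul]
    refine Finset.sum_congr rfl fun n _ => ?_
    rw [Matrix.mul_smul, comm, Matrix.smul_mul]
  rw [vnEntropy, vnEntropy, e1, e2, Matrix.mul_assoc, comm', ← Matrix.mul_assoc,
    Matrix.trace_mul_comm, ← Matrix.mul_assoc]

lemma sum_eigenvalues_eq_one {ι : Type*} [Fintype ι] [DecidableEq ι] {ρ : Matrix ι ι ℂ}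
    (h : ρ.IsHermitian) (htr : ρ.trace = 1) : ∑ i, h.eigenvalues i = 1 := by
  have := h.trace_eq_sum_eigenvalues
  rw [htr] at this
  have h2 : ((∑ i, h.eigenvalues i : ℝ) : ℂ) = 1 := by
    rw [Complex.ofReal_sum]
    exact this.symm
  exact_mod_cast h2

/-- Peierls' inequality for `x ↦ -x log x`: the diagonal in any orthonormal basis has at least the
entropy of the matrix. -/
lemma sum_negMulLog_eigenvalues_le {ι : Type*} [Fintype ι] [DecidableEq ι] {ρ : Matrix ι ι ℂ}
    (h : ρ.PosSemidef) (U : Matrix.unitaryGroup ι ℂ) :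
    ∑ i, Real.negMulLog (h.1.eigenvalues i)
      ≤ ∑ b, Real.negMulLog ((star (U : Matrix ι ι ℂ) * ρ * (U : Matrix ι ι ℂ)) b b).re := by
  set V := h.1.eigenvectorUnitary
  set W : Matrix.unitaryGroup ι ℂ := star U * V with hW
  -- The squared moduli of the entries of a unitary matrix are doubly stochastic. The diagonal is
  -- this matrix applied to the eigenvalues, so Jensen's inequality applies in each row and the
  -- columns sum back to 1.
  set w : ι → ι → ℝ := fun b a => Complex.normSq ((W : Matrix ι ι ℂ) b a) with hw
  have row : ∀ b, ∑ a, w b a = 1 := by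
    intro b
    have := congrFun (congrFun (Unitary.coe_mul_star_self W) b) b
    rw [Matrix.mul_apply, Matrix.one_apply_eq] at this
    have h2 : ((∑ a, w b a : ℝ) : ℂ) = 1 := by
      rw [← this]
      push_cast
      refine Finset.sum_congr rfl fun a _ => ?_
      rw [Matrix.star_apply, hw]
      exact Complex.mul_conj _ |>.symm
    exact_mod_cast h2
  have col : ∀ a, ∑ b, w b a = 1 := by
    intro a
    have := congrFun (congrFun (Unitary.coe_star_mul_self W) a) a
    rw [Matrix.mul_apply, Matrix.one_apply_eq] at this
    have h2 : ((∑ b, w b a : ℝ) : ℂ) = 1 := by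
      rw [← this]
      push_cast
      refine Finset.sum_congr rfl fun b _ => ?_
      rw [Matrix.star_apply, hw, mul_comm]
      exact Complex.mul_conj _ |>.symm
    exact_mod_cast h2
  have diag : ∀ b, ((star (U : Matrix ι ι ℂ) * ρ * (U : Matrix ι ι ℂ)) b b).re
      = ∑ a, w b a * h.1.eigenvalues a := by
    intro b
    have e : star (U : Matrix ι ι ℂ) * ρ * (U : Matrix ι ι ℂ)
        = (W : Matrix ι ι ℂ) * Matrix.diagonal (RCLike.ofReal ∘ h.1.eigenvalues)
          * star (W : Matrix ι ι ℂ) := by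
      conv_lhs => rw [h.1.spectral_theorem, Unitary.conjStarAlgAut_apply]
      simp [hW, V, Matrix.mul_assoc, star_mul]
    rw [e, Matrix.mul_apply, Complex.re_sum]
    refine Finset.sum_congr rfl fun a _ => ?_
    rw [Matrix.mul_diagonal, Matrix.star_apply, mul_right_comm]
    have : (W : Matrix ι ι ℂ) b a * star ((W : Matrix ι ι ℂ) b a) = (w b a : ℂ) :=
      Complex.mul_conj _
    rw [this]
    simp [← Complex.ofReal_mul]
  calc ∑ i, Real.negMulLog (h.1.eigenvalues i)
      = ∑ b, ∑ a, w b a * Real.negMulLog (h.1.eigenvalues a) := by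
        rw [Finset.sum_comm]
        refine Finset.sum_congr rfl fun a _ => ?_
        rw [← Finset.sum_mul, col, one_mul]
    _ ≤ _ := by
        refine Finset.sum_le_sum fun b _ => ?_
        rw [diag]
        have := Real.concaveOn_negMulLog.le_map_sum (t := Finset.univ) (w := w b)
          (p := h.1.eigenvalues) (fun a _ => Complex.normSq_nonneg _) (row b)
          (fun a _ => h.eigenvalues_nonneg a)
        simpa [smul_eq_mul] using this

/-- Concavity of the von Neumann entropy. -/
lemma sum_mul_vnEntropy_le {ι σ : Type*} [Fintype ι] [DecidableEq ι] (s : Finset σ) (q : σ → ℝ)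
    (ρ : σ → Matrix ι ι ℂ) (hq : ∀ i ∈ s, 0 ≤ q i) (hsum : ∑ i ∈ s, q i = 1)
    (hρ : ∀ i ∈ s, (ρ i).PosSemidef) :
    ∑ i ∈ s, q i * vnEntropy (ρ i) ≤ vnEntropy (∑ i ∈ s, (q i : ℂ) • ρ i) := by
  have hp : (∑ i ∈ s, (q i : ℂ) • ρ i).PosSemidef := by
    refine Matrix.posSemidef_sum _ fun i hi => (hρ i hi).smul ?_
    exact_mod_cast hq i hi
  -- In an eigenbasis of the mixture its entropy is that of its diagonal. Each component has at most
  -- the entropy of its diagonal there, so only scalar concavity is left.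
  set U := hp.1.eigenvectorUnitary
  have hl2 : 0 < Real.log 2 := Real.log_pos (by norm_num)
  have hd : ∀ b, hp.1.eigenvalues b
      = ∑ i ∈ s, q i * ((star (U : Matrix ι ι ℂ) * ρ i * (U : Matrix ι ι ℂ)) b b).re := by
    intro b
    have h1 := congrFun (congrFun hp.1.conjStarAlgAut_star_eigenvectorUnitary b) b
    rw [Unitary.conjStarAlgAut_star_apply, Matrix.diagonal_apply_eq] at h1
    have h2 := congrArg Complex.re h1
    rw [Matrix.mul_sum, Matrix.sum_mul, Matrix.sum_apply, Complex.re_sum] at h2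
    simp only [Function.comp_apply, Complex.coe_algebraMap, RCLike.ofReal] at h2
    erw [Complex.ofReal_re] at h2
    rw [← h2]
    refine Finset.sum_congr rfl fun i _ => ?_
    rw [Matrix.mul_smul, Matrix.smul_mul, Matrix.smul_apply, smul_eq_mul, Complex.re_ofReal_mul]
  rw [vnEntropy_eq_sum hp.1]
  have hnn : ∀ i ∈ s, ∀ b, 0 ≤ ((star (U : Matrix ι ι ℂ) * ρ i * (U : Matrix ι ι ℂ)) b b).re := by
    intro i hi b
    have := ((hρ i hi).conjTranspose_mul_mul_same (U : Matrix ι ι ℂ)).diag_nonneg (i := b)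
    exact (Complex.le_def.1 this).1
  calc ∑ i ∈ s, q i * vnEntropy (ρ i)
      ≤ ∑ i ∈ s, q i * ((∑ b, Real.negMulLog
          ((star (U : Matrix ι ι ℂ) * ρ i * (U : Matrix ι ι ℂ)) b b).re) / Real.log 2) := by
        refine Finset.sum_le_sum fun i hi => mul_le_mul_of_nonneg_left ?_ (hq i hi)
        rw [vnEntropy_eq_sum (hρ i hi).1]
        exact div_le_div_of_nonneg_right (sum_negMulLog_eigenvalues_le (hρ i hi) U) hl2.le
    _ = (∑ b, ∑ i ∈ s, q i * Real.negMulLog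
          ((star (U : Matrix ι ι ℂ) * ρ i * (U : Matrix ι ι ℂ)) b b).re) / Real.log 2 := by
        rw [Finset.sum_comm, Finset.sum_div]
        refine Finset.sum_congr rfl fun i _ => ?_
        rw [← Finset.mul_sum, mul_div_assoc]
    _ ≤ _ := by
        refine div_le_div_of_nonneg_right (Finset.sum_le_sum fun b _ => ?_) hl2.le
        rw [hd]
        have := Real.concaveOn_negMulLog.le_map_sum (t := s) (w := q)
          (p := fun i => ((star (U : Matrix ι ι ℂ) * ρ i * (U : Matrix ι ι ℂ)) b b).re)
          hq hsum (fun i hi => hnn i hi b)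
        simpa [smul_eq_mul] using this

/-- The Rényi-2 entropy is a lower bound. It comes from log x ≤ x - 1 at x = λ/P, summed over the
eigenvalues λ with weights λ; this gives lower bounds on entropy from overlap counts, with no
spectrum to compute. -/
lemma neg_logb_le_vnEntropy {ι : Type*} [Fintype ι] [DecidableEq ι] {ρ : Matrix ι ι ℂ}
    (h : ρ.PosSemidef) (htr : ρ.trace = 1) {P : ℝ} (hP : 0 < P)
    (hle : (Matrix.trace (ρ * ρ)).re ≤ P) : -Real.logb 2 P ≤ vnEntropy ρ := by
  have hsq : ∑ i, h.1.eigenvalues i ^ 2 ≤ P := by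
    have e : ρ * ρ = cfc (fun x : ℝ => x ^ 2) ρ := by
      rw [cfc_pow_id ρ 2 h.1.isSelfAdjoint, sq]
    rwa [e, h.1.trace_cfc, Complex.ofReal_re] at hle
  have h1 := sum_eigenvalues_eq_one h.1 htr
  rw [vnEntropy_eq_sum h.1, Real.logb, ← neg_div]
  refine div_le_div_of_nonneg_right ?_ (Real.log_pos (by norm_num)).le
  have key : ∀ i, h.1.eigenvalues i * (-Real.log P) + h.1.eigenvalues i
      - h.1.eigenvalues i ^ 2 / P ≤ Real.negMulLog (h.1.eigenvalues i) := by
    intro i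
    have hn := h.eigenvalues_nonneg i
    rcases hn.eq_or_lt with h0 | h0
    · simp [← h0]
    · have := Real.log_le_sub_one_of_pos (div_pos h0 hP)
      rw [Real.log_div h0.ne' hP.ne'] at this
      have h3 := mul_le_mul_of_nonneg_left this hn
      rw [Real.negMulLog]
      have : h.1.eigenvalues i * (h.1.eigenvalues i / P - 1)
        = h.1.eigenvalues i ^ 2 / P - h.1.eigenvalues i := by ring
      linarith
  have h2 := Finset.sum_le_sum fun i (_ : i ∈ Finset.univ) => key i
  rw [Finset.sum_sub_distrib, Finset.sum_add_distrib, ← Finset.sum_mul, ← Finset.sum_div, h1] at h2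
  have : (∑ i, h.1.eigenvalues i ^ 2) / P ≤ 1 := (div_le_one hP).2 hsq
  linarith

lemma sum_negMulLog_le_log_card {ι : Type*} [Fintype ι] {p : ι → ℝ} (h0 : ∀ i, 0 ≤ p i)
    (h1 : ∑ i, p i = 1) : ∑ i, Real.negMulLog (p i) ≤ Real.log (Fintype.card ι) := by
  have hne : Nonempty ι := by
    by_contra hne
    rw [not_nonempty_iff] at hne
    simp at h1
  have hd : (0 : ℝ) < Fintype.card ι := by exact_mod_cast Fintype.card_pos
  have key : ∀ i, Real.negMulLog (p i) ≤
      p i * Real.log (Fintype.card ι) + 1 / Fintype.card ι - p i := by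
    intro i
    rcases (h0 i).eq_or_lt with h | h
    · simp [← h]
    · have := Real.log_le_sub_one_of_pos (inv_pos.2 (mul_pos h hd))
      rw [Real.log_inv, Real.log_mul h.ne' hd.ne'] at this
      have h3 := mul_le_mul_of_nonneg_left this (h0 i)
      rw [Real.negMulLog]
      have : p i * ((p i * Fintype.card ι)⁻¹ - 1) = 1 / Fintype.card ι - p i := by field_simp
      linarith
  have h2 := Finset.sum_le_sum fun i (_ : i ∈ Finset.univ) => key i
  rw [Finset.sum_sub_distrib, Finset.sum_add_distrib, ← Finset.sum_mul, h1] at h2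
  simp only [Finset.sum_const, Finset.card_univ, nsmul_eq_mul] at h2
  rw [mul_one_div_cancel hd.ne'] at h2
  linarith

lemma vnEntropy_le_logb_card {ι : Type*} [Fintype ι] [DecidableEq ι] {ρ : Matrix ι ι ℂ}
    (h : ρ.PosSemidef) (htr : ρ.trace = 1) : vnEntropy ρ ≤ Real.logb 2 (Fintype.card ι) := by
  rw [vnEntropy_eq_sum h.1, Real.logb]
  exact div_le_div_of_nonneg_right (sum_negMulLog_le_log_card h.eigenvalues_nonneg
    (sum_eigenvalues_eq_one h.1 htr)) (Real.log_pos (by norm_num)).le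

lemma shannonEntropy_eq_sum {X : Type*} [Fintype X] (p : X → ℝ) :
    shannonEntropy p = (∑ x, Real.negMulLog (p x)) / Real.log 2 := by
  rw [shannonEntropy, Finset.sum_div]
  refine Finset.sum_congr rfl fun x _ => ?_
  rw [Real.logb, one_div, Real.log_inv, Real.negMulLog]
  ring

/-- The dimension bound and the purity bound with P = 1/d coincide. -/
lemma vnEntropy_uniform {ι : Type*} [Fintype ι] [DecidableEq ι] [Nonempty ι] :
    vnEntropy ((1 / (Fintype.card ι : ℂ)) • (1 : Matrix ι ι ℂ))
      = Real.logb 2 (Fintype.card ι) := by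
  have hd : (0 : ℝ) < Fintype.card ι := by exact_mod_cast Fintype.card_pos
  have hd' : (Fintype.card ι : ℂ) ≠ 0 := by exact_mod_cast hd.ne'
  have hp : ((1 / (Fintype.card ι : ℂ)) • (1 : Matrix ι ι ℂ)).PosSemidef := by
    refine Matrix.PosSemidef.one.smul ?_
    rw [show (1 / (Fintype.card ι : ℂ)) = ((1 / (Fintype.card ι : ℝ) : ℝ) : ℂ) by push_cast; rfl]
    exact_mod_cast (one_div_pos.2 hd).le
  have ht : ((1 / (Fintype.card ι : ℂ)) • (1 : Matrix ι ι ℂ)).trace = 1 := by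
    simp [Matrix.trace_smul, hd']
  refine le_antisymm (vnEntropy_le_logb_card hp ht) ?_
  have := neg_logb_le_vnEntropy hp ht (P := 1 / Fintype.card ι) (one_div_pos.2 hd) (by
    apply le_of_eq
    simp only [Matrix.mul_smul, mul_one, Matrix.trace_smul, Matrix.trace_one,
      smul_eq_mul]
    rw [one_div_mul_cancel hd', mul_one, ← Complex.ofReal_natCast, ← Complex.ofReal_one,
      ← Complex.ofReal_div, Complex.ofReal_re])
  rwa [one_div, Real.logb_inv, neg_neg] at this

/-! ### The ensemble of samples and its Gram matrix. -/

lemma card_KSet (n k : ℕ) : Fintype.card (KSet n k) = n.choose k := by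
  rw [Fintype.card_finset_len, Fintype.card_fin]

lemma star_sample {n k : ℕ} (S : KSet n k) (i : Fin n) :
    (starRingEnd ℂ) (sample S i) = sample S i := by
  unfold sample
  split_ifs
  · exact Complex.conj_ofReal _
  · simp

lemma star_samples {n k t : ℕ} (S : KSet n k) (u : Fin t → Fin n) :
    (starRingEnd ℂ) (samples t S u) = samples t S u := by
  simp [samples, map_prod, star_sample]

lemma sum_sample_mul_sample {n k : ℕ} (S T : KSet n k) :
    ∑ i, sample S i * sample T i = (((S.1 ∩ T.1).card / k : ℝ) : ℂ) := by
  have h : ∀ i, sample S i * sample T i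
      = if i ∈ S.1 ∩ T.1 then ((1 / k : ℝ) : ℂ) else 0 := by
    intro i
    by_cases h1 : i ∈ S.1 <;> by_cases h2 : i ∈ T.1 <;> simp [sample, h1, h2]
    rw [← mul_inv, ← Complex.ofReal_mul, Real.mul_self_sqrt (Nat.cast_nonneg k)]
    simp
  simp_rw [h]
  rw [Finset.sum_ite_mem, Finset.univ_inter, Finset.sum_const, nsmul_eq_mul]
  push_cast
  ring

lemma sum_samples_mul_samples {n k : ℕ} (t : ℕ) (S T : KSet n k) :
    ∑ u, samples t S u * samples t T u = ((((S.1 ∩ T.1).card / k : ℝ) ^ t : ℝ) : ℂ) := by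
  simp only [samples, ← Finset.prod_mul_distrib]
  rw [← Fintype.sum_pow (fun i => sample S i * sample T i) t, sum_sample_mul_sample]
  push_cast
  rfl

lemma sum_samples_mul_self {n k : ℕ} (hk : k ≠ 0) (t : ℕ) (S : KSet n k) :
    ∑ u, samples t S u * samples t S u = 1 := by
  rw [sum_samples_mul_samples, Finset.inter_self, S.2, div_self (by exact_mod_cast hk)]
  simp

lemma samplesState_apply {n k t : ℕ} (S : KSet n k) (u v : Fin t → Fin n) :
    samplesState t S u v = samples t S u * samples t S v := by
  rw [samplesState, Matrix.vecMulVec_apply, Pi.star_apply]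
  congr 1
  exact star_samples S v

/-- The normalized Gram matrix of the ensemble. -/
def gram (n k t : ℕ) : Matrix (KSet n k) (KSet n k) ℂ :=
  Matrix.of fun S T => ((1 / (n.choose k) * ((S.1 ∩ T.1).card / k) ^ t : ℝ) : ℂ)

lemma stateAB_apply {n k t : ℕ} (S T : KSet n k) (u v : Fin t → Fin n) :
    stateAB n k t (S, u) (T, v)
      = if S = T then (1 / (n.choose k : ℂ)) * (samples t S u * samples t S v) else 0 := by
  rw [stateAB, Matrix.smul_apply, Matrix.sum_apply, smul_eq_mul]
  simp only [Matrix.kroneckerMap_apply, samplesState_apply, Matrix.single_apply]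
  by_cases h : S = T
  · subst h
    rw [if_pos rfl, Finset.sum_eq_single S]
    · simp
    · intro b _ hb
      simp [hb]
    · simp
  · rw [if_neg h, Finset.sum_eq_zero, mul_zero]
    intro b _
    have : ¬(b = S ∧ b = T) := fun hb => h (hb.1 ▸ hb.2)
    simp [this]

lemma inv_sqrt_mul_inv_sqrt (N : ℕ) :
    ((1 / Real.sqrt N : ℝ) : ℂ) * ((1 / Real.sqrt N : ℝ) : ℂ) = 1 / (N : ℂ) := by
  rw [← Complex.ofReal_mul, div_mul_div_comm, Real.mul_self_sqrt (Nat.cast_nonneg _)]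
  simp

/-- The samples, normalized so that their uniform mixture is a product with the adjoint. -/
def samplesMatrix (n k t : ℕ) : Matrix (Fin t → Fin n) (KSet n k) ℂ :=
  Matrix.of fun u S => ((1 / Real.sqrt (n.choose k) : ℝ) : ℂ) * samples t S u

lemma stateB_eq {n k t : ℕ} :
    stateB n k t = samplesMatrix n k t * (samplesMatrix n k t).conjTranspose := by
  ext u v
  simp only [stateB, marginalSnd, Matrix.of_apply, stateAB_apply, Matrix.mul_apply,
    Matrix.conjTranspose_apply, samplesMatrix, if_true]
  refine Finset.sum_congr rfl fun S _ => ?_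
  rw [star_mul, ← inv_sqrt_mul_inv_sqrt]
  rw [Complex.star_def, star_samples, Complex.conj_ofReal]
  ring

lemma gram_eq {n k t : ℕ} :
    gram n k t = (samplesMatrix n k t).conjTranspose * samplesMatrix n k t := by
  ext S T
  simp only [gram, Matrix.of_apply, Matrix.mul_apply, Matrix.conjTranspose_apply, samplesMatrix]
  rw [Complex.ofReal_mul, ← sum_samples_mul_samples, Finset.mul_sum]
  refine Finset.sum_congr rfl fun u _ => ?_
  rw [star_mul, Complex.star_def, star_samples, Complex.conj_ofReal]
  push_cast
  rw [← inv_sqrt_mul_inv_sqrt]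
  push_cast
  ring

lemma gram_posSemidef {n k t : ℕ} : (gram n k t).PosSemidef := by
  rw [gram_eq]
  exact Matrix.posSemidef_conjTranspose_mul_self _

lemma vnEntropy_stateB {n k t : ℕ} : vnEntropy (stateB n k t) = vnEntropy (gram n k t) := by
  rw [stateB_eq, gram_eq, vnEntropy_mul_conjTranspose_comm]

lemma gram_trace {n k t : ℕ} (hk : k ≠ 0) (hkn : k ≤ n) : (gram n k t).trace = 1 := by
  have hN : (n.choose k : ℂ) ≠ 0 := by exact_mod_cast (Nat.choose_pos hkn).ne'
  have hk' : (k : ℝ) ≠ 0 := by exact_mod_cast hk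
  have : ∀ S : KSet n k, gram n k t S S = 1 / (n.choose k : ℂ) := by
    intro S
    rw [gram, Matrix.of_apply, Finset.inter_self, S.2, div_self hk']
    simp
  simp only [Matrix.trace, Matrix.diag_apply, this, Finset.sum_const, Finset.card_univ, card_KSet,
    nsmul_eq_mul]
  field_simp

lemma KSet_nonempty {n k : ℕ} (hkn : k ≤ n) : Nonempty (KSet n k) := by
  rw [← Fintype.card_pos_iff, card_KSet]
  exact Nat.choose_pos hkn

/-- The Gram matrix has size C(n,k) whatever `t` is, so the dimension bound applies to it rather
than to the space of `t` samples. -/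
lemma vnEntropy_stateB_le {n k t : ℕ} (hk : k ≠ 0) (hkn : k ≤ n) :
    vnEntropy (stateB n k t) ≤ Real.logb 2 (n.choose k) := by
  rw [vnEntropy_stateB, ← card_KSet]
  exact vnEntropy_le_logb_card gram_posSemidef (gram_trace hk hkn)

lemma vnEntropy_marginalFst_stateAB {n k t : ℕ} (hk : k ≠ 0) (hkn : k ≤ n) :
    vnEntropy (marginalFst (stateAB n k t)) = Real.logb 2 (n.choose k) := by
  have := KSet_nonempty hkn
  rw [← card_KSet, ← vnEntropy_uniform]
  congr 1
  ext S T
  simp only [marginalFst, Matrix.of_apply, stateAB_apply, Matrix.smul_apply, Matrix.one_apply,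
    card_KSet]
  split_ifs
  · rw [← Finset.mul_sum, sum_samples_mul_self hk, smul_eq_mul]
  · simp

/-- The register `A` makes the states orthogonal: the state is W W* with W a multiple of an
isometry, so W* W is the maximally mixed state on sets. -/
lemma vnEntropy_stateAB {n k t : ℕ} (hk : k ≠ 0) (hkn : k ≤ n) :
    vnEntropy (stateAB n k t) = Real.logb 2 (n.choose k) := by
  have := KSet_nonempty hkn
  set W : Matrix (KSet n k × (Fin t → Fin n)) (KSet n k) ℂ := Matrix.of fun x T =>
    if x.1 = T then ((1 / Real.sqrt (n.choose k) : ℝ) : ℂ) * samples t x.1 x.2 else 0 with hW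
  have e1 : stateAB n k t = W * W.conjTranspose := by
    ext ⟨S, u⟩ ⟨T, v⟩
    rw [stateAB_apply, Matrix.mul_apply]
    simp only [hW, Matrix.conjTranspose_apply, Matrix.of_apply, ite_mul, zero_mul,
      Finset.sum_ite_eq, Finset.mem_univ, if_true]
    by_cases h : S = T
    · subst h
      simp only [if_true]
      rw [star_mul, ← inv_sqrt_mul_inv_sqrt]
      rw [Complex.star_def, star_samples, Complex.conj_ofReal]
      ring
    · simp [h, Ne.symm h]
  have e2 : W.conjTranspose * W
      = (1 / (Fintype.card (KSet n k) : ℂ)) • (1 : Matrix (KSet n k) (KSet n k) ℂ) := by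
    ext S T
    rw [Matrix.mul_apply, Fintype.sum_prod_type]
    simp only [hW, Matrix.conjTranspose_apply, Matrix.of_apply, Matrix.smul_apply,
      Matrix.one_apply, card_KSet]
    rw [Finset.sum_eq_single S]
    · by_cases h : S = T
      · subst h
        simp only [if_true]
        rw [smul_eq_mul, mul_one, ← inv_sqrt_mul_inv_sqrt, ← mul_one (_ * _),
          ← sum_samples_mul_self hk t S, Finset.mul_sum]
        refine Finset.sum_congr rfl fun u _ => ?_
        rw [star_mul, Complex.star_def, star_samples, Complex.conj_ofReal]
        ring
      · simp [h]
    · intro b _ hb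
      simp [hb]
    · simp
  rw [e1, vnEntropy_mul_conjTranspose_comm, e2, vnEntropy_uniform, card_KSet]

lemma qMutualInfo_stateAB {n k t : ℕ} (hk : k ≠ 0) (hkn : k ≤ n) :
    qMutualInfo (stateAB n k t) = vnEntropy (stateB n k t) := by
  rw [qMutualInfo, vnEntropy_marginalFst_stateAB hk hkn, vnEntropy_stateAB hk hkn]
  rw [stateB]
  ring

lemma shannonEntropy_uniformSet {n k : ℕ} (hkn : k ≤ n) :
    shannonEntropy (uniformSet n k) = Real.logb 2 (n.choose k) := by
  have hN : (n.choose k : ℝ) ≠ 0 := by exact_mod_cast (Nat.choose_pos hkn).ne'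
  simp only [shannonEntropy, uniformSet, Finset.sum_const, Finset.card_univ, card_KSet,
    nsmul_eq_mul, one_div_one_div]
  field_simp

/-! ### Coupon weights and binomial estimates. -/

/-- The distribution of the number of distinct coupons, out of `m`, seen in `t` draws that hit each
coupon with probability `1 / k`: it mixes the kernels `C(x, j) / C(m, j)` to `(1 - (m - x) / k) ^ t`. -/
lemma exists_coupon_weights {m k : ℕ} (hmk : m ≤ k) (hk : 0 < k) (t : ℕ) :
    ∃ q : ℕ → ℝ, (∀ j ∈ Finset.range (m + 1), 0 ≤ q j) ∧ ∑ j ∈ Finset.range (m + 1), q j = 1 ∧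
      ∑ j ∈ Finset.range (m + 1), q j * j = m * (1 - (1 - 1 / (k : ℝ)) ^ t) ∧
      ∀ x ≤ m, ∑ j ∈ Finset.range (m + 1), q j * ((x.choose j : ℝ) / m.choose j)
        = (((k : ℝ) - m + x) / k) ^ t := by
  have hk' : (k : ℝ) ≠ 0 := by exact_mod_cast hk.ne'
  have hmk' : (m : ℝ) ≤ k := by exact_mod_cast hmk
  induction t with
  | zero =>
    refine ⟨fun j => if j = 0 then 1 else 0, fun j _ => ?_, ?_, ?_, fun x _ => ?_⟩
    · dsimp only
      split_ifs <;> norm_num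
    all_goals simp
  | succ t ih =>
    obtain ⟨q, h0, h1, h2, h3⟩ := ih
    -- With j coupons already seen, the next draw is new with probability (m - j)/k and leaves j
    -- unchanged otherwise.
    set q' : ℕ → ℝ := fun j => q j * (((k : ℝ) - m + j) / k)
      + (match j with
        | 0 => 0
        | i + 1 => q i * (((m : ℝ) - i) / k)) with hq'
    -- The transition moved from the weights onto the test function. Nothing leaves the range,
    -- because the upward rate vanishes at j = m.
    have step : ∀ g : ℕ → ℝ, ∑ j ∈ Finset.range (m + 1), q' j * g j
        = ∑ j ∈ Finset.range (m + 1), q j *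
          (((k : ℝ) - m + j) / k * g j + ((m : ℝ) - j) / k * g (j + 1)) := by
      intro g
      simp only [hq', add_mul, mul_add, Finset.sum_add_distrib]
      congr 1
      · exact Finset.sum_congr rfl fun j _ => by ring
      · rw [Finset.sum_range_succ', Finset.sum_range_succ]
        simp only [zero_mul, add_zero, sub_self, zero_div, mul_zero]
        exact Finset.sum_congr rfl fun j _ => by ring
    refine ⟨q', ?_, ?_, ?_, fun x hx => ?_⟩
    · intro j hj
      rw [Finset.mem_range] at hj
      refine add_nonneg (mul_nonneg (h0 j (Finset.mem_range.2 hj)) ?_) ?_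
      · exact div_nonneg (by linarith [(Nat.cast_nonneg j : (0 : ℝ) ≤ j)]) (Nat.cast_nonneg _)
      · rcases j with _ | i
        · exact le_rfl
        · refine mul_nonneg (h0 i (Finset.mem_range.2 (by omega))) ?_
          have : (i : ℝ) ≤ m := by exact_mod_cast (by omega : i ≤ m)
          exact div_nonneg (by linarith) (Nat.cast_nonneg _)
    · have := step fun _ => 1
      simp only [mul_one] at this
      rw [this, ← h1]
      refine Finset.sum_congr rfl fun j _ => ?_
      field_simp
      ring
    · rw [step]
      have : ∀ j : ℕ, q j * (((k : ℝ) - m + j) / k * j + ((m : ℝ) - j) / k * ((j + 1 : ℕ) : ℝ))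
          = (1 - 1 / (k : ℝ)) * (q j * j) + (m / k) * q j := by
        intro j
        push_cast
        field_simp
        ring
      simp_rw [this]
      rw [Finset.sum_add_distrib, ← Finset.mul_sum, ← Finset.mul_sum, h1, h2, pow_succ]
      generalize (1 - 1 / (k : ℝ)) ^ t = w
      field_simp
      ring
    · rw [step, pow_succ, ← h3 x hx, Finset.sum_mul]
      refine Finset.sum_congr rfl fun j hj => ?_
      rw [Finset.mem_range] at hj
      rw [mul_assoc]
      congr 1
      have e2 : ((x.choose (j + 1) : ℝ)) * (j + 1) = x.choose j * ((x : ℝ) - j) := by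
        rcases le_or_gt j x with h | h
        · have := Nat.choose_succ_right_eq x j
          rw [← Nat.cast_sub h]
          exact_mod_cast this
        · rw [Nat.choose_eq_zero_of_lt h, Nat.choose_eq_zero_of_lt (by omega : x < j + 1)]
          simp
      have e1 : ((m.choose (j + 1) : ℝ)) * (j + 1) = m.choose j * ((m : ℝ) - j) := by
        have := Nat.choose_succ_right_eq m j
        rw [← Nat.cast_sub (by omega : j ≤ m)]
        exact_mod_cast this
      have p0 : (m.choose j : ℝ) ≠ 0 := by exact_mod_cast (Nat.choose_pos (by omega)).ne'
      -- This makes C(x,j)/C(m,j) an eigenfunction of the transition: (k - m + j) + (x - j) = k - m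
      -- + x does not depend on j. At j = m the quotient C(x,m+1)/C(m,m+1) is 0/0 = 0, and both
      -- sides vanish.
      have key : ((m : ℝ) - j) * ((x.choose (j + 1) : ℝ) / m.choose (j + 1))
          = ((x : ℝ) - j) * ((x.choose j : ℝ) / m.choose j) := by
        rcases (by omega : j = m ∨ j + 1 ≤ m) with h | h
        · subst h
          rw [sub_self, zero_mul, Nat.choose_self]
          rcases hx.eq_or_lt with h'' | h''
          · simp [h'']
          · simp [Nat.choose_eq_zero_of_lt h'']
        · have p1 : (m.choose (j + 1) : ℝ) ≠ 0 := by exact_mod_cast (Nat.choose_pos h).ne'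
          have j1 : (j : ℝ) + 1 ≠ 0 := by positivity
          rw [mul_div_assoc', mul_div_assoc', div_eq_div_iff p1 p0]
          apply mul_right_cancel₀ j1
          linear_combination ((m : ℝ) - j) * m.choose j * e2 - ((x : ℝ) - j) * x.choose j * e1
      rw [div_mul_eq_mul_div, div_mul_eq_mul_div, ← add_div, key]
      ring

lemma sum_choose_mul_choose {j k y : ℕ} (hjk : j ≤ k) (hy : y ≤ j) (N : ℕ) :
    ∑ i ∈ Finset.range (j + 1), y.choose i * N.choose (k - i) = (y + N).choose k := by
  rw [Nat.add_choose_eq,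
    Finset.Nat.sum_antidiagonal_eq_sum_range_succ (fun a b => y.choose a * N.choose b)]
  refine Finset.sum_subset (Finset.range_mono (by omega)) fun i _ hi => ?_
  rw [Finset.mem_range] at hi
  rw [Nat.choose_eq_zero_of_lt (by omega), zero_mul]

lemma choose_mul_pow_le_choose {i c N : ℕ} (h : c * i ≤ N) (hc : 1 ≤ c) (s : ℕ) :
    i.choose s * c ^ s ≤ N.choose s := by
  induction s with
  | zero => simp
  | succ s ih =>
    refine Nat.le_of_mul_le_mul_right (c := s + 1) ?_ (Nat.succ_pos s)
    rw [Nat.choose_succ_right_eq, mul_right_comm, Nat.choose_succ_right_eq]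
    calc i.choose s * (i - s) * c ^ (s + 1) = (i.choose s * c ^ s) * (c * (i - s)) := by ring
      _ ≤ N.choose s * (N - s) := by
        refine Nat.mul_le_mul ih ?_
        rw [Nat.mul_sub]
        have : s ≤ c * s := Nat.le_mul_of_pos_left s hc
        omega

/-- Since 9i ≤ n - i, one has C(i,s) ≤ 9^(-s) C(n-i,s), and the trinomial identity bounds each term
by C(n-i,a) (C(a,s) 3^(-s))². A sum of squares is at most the square of the sum (4/3)^a, and 16/9 ≤
2. This is the source of the condition 10m ≤ n. -/
lemma sum_choose_mul_choose_mul_choose_le {n i a : ℕ} (h : 10 * (i + a) ≤ n) :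
    ∑ s ∈ Finset.range (i + 1), ((i.choose s * (a.choose s * (n - i - s).choose (a - s)) : ℕ) : ℝ)
      ≤ 2 ^ a * (n - i).choose a := by
  set f : ℕ → ℝ := fun s => a.choose s * (1 / 3 : ℝ) ^ s with hf
  have hf0 : ∀ s, 0 ≤ f s := fun s => by positivity
  have term : ∀ s ∈ Finset.range (i + 1),
      ((i.choose s * (a.choose s * (n - i - s).choose (a - s)) : ℕ) : ℝ)
        ≤ (n - i).choose a * f s ^ 2 := by
    intro s _
    rcases le_or_gt s a with hs | hs
    · have e := Nat.choose_mul (n := n - i) hs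
      have e9 := choose_mul_pow_le_choose (i := i) (c := 9) (N := n - i) (by omega) (by norm_num) s
      have h1 : i.choose s * (a.choose s * (n - i - s).choose (a - s)) * 9 ^ s
          ≤ (n - i).choose a * a.choose s ^ 2 :=
        calc i.choose s * (a.choose s * (n - i - s).choose (a - s)) * 9 ^ s
            = (i.choose s * 9 ^ s) * (a.choose s * (n - i - s).choose (a - s)) := by ring
          _ ≤ (n - i).choose s * (a.choose s * (n - i - s).choose (a - s)) :=
            Nat.mul_le_mul_right _ e9
          _ = a.choose s * ((n - i).choose s * (n - i - s).choose (a - s)) := by ring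
          _ = _ := by rw [← e]; ring
      have h2 : (((i.choose s * (a.choose s * (n - i - s).choose (a - s)) : ℕ) : ℝ)) * 9 ^ s
          ≤ (n - i).choose a * (a.choose s : ℝ) ^ 2 := by exact_mod_cast h1
      have h9 : ((1 / 3 : ℝ) ^ s) ^ 2 * 9 ^ s = 1 := by
        rw [← pow_mul, mul_comm s 2, pow_mul, ← mul_pow]
        norm_num
      have hpos : (0 : ℝ) < 9 ^ s := by positivity
      refine le_of_mul_le_mul_right (h2.trans (le_of_eq ?_)) hpos
      simp only [hf]
      rw [mul_pow, mul_assoc, mul_assoc, h9, mul_one]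
    · rw [Nat.choose_eq_zero_of_lt hs]
      simp only [zero_mul, mul_zero, Nat.cast_zero]
      positivity
  have sumf : ∑ s ∈ Finset.range (i + 1), f s ≤ (4 / 3) ^ a := by
    calc ∑ s ∈ Finset.range (i + 1), f s ≤ ∑ s ∈ Finset.range (i + a + 1), f s :=
          Finset.sum_le_sum_of_subset_of_nonneg (Finset.range_mono (by omega)) fun s _ _ => hf0 s
      _ = ∑ s ∈ Finset.range (a + 1), f s := by
          refine (Finset.sum_subset (Finset.range_mono (by omega)) fun s _ hs => ?_).symm
          rw [Finset.mem_range] at hs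
          simp only [hf]
          rw [Nat.choose_eq_zero_of_lt (by omega)]
          simp
      _ = (4 / 3) ^ a := by
          have := add_pow (1 / 3 : ℝ) 1 a
          rw [show (4 / 3 : ℝ) = 1 / 3 + 1 by norm_num, this]
          refine Finset.sum_congr rfl fun s _ => ?_
          simp only [hf]
          ring
  calc _ ≤ ∑ s ∈ Finset.range (i + 1), ((n - i).choose a : ℝ) * f s ^ 2 := Finset.sum_le_sum term
    _ = (n - i).choose a * ∑ s ∈ Finset.range (i + 1), f s ^ 2 := by rw [Finset.mul_sum]
    _ ≤ (n - i).choose a * (∑ s ∈ Finset.range (i + 1), f s) ^ 2 := by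
        gcongr
        exact Finset.sum_sq_le_sq_sum_of_nonneg fun s _ => hf0 s
    _ ≤ (n - i).choose a * 2 ^ a := by
        gcongr
        calc (∑ s ∈ Finset.range (i + 1), f s) ^ 2 ≤ ((4 / 3 : ℝ) ^ a) ^ 2 := by
              gcongr
          _ = ((4 / 3 : ℝ) ^ 2) ^ a := by rw [← pow_mul, mul_comm, pow_mul]
          _ ≤ 2 ^ a := by gcongr; norm_num
    _ = _ := by ring

lemma logb_choose_succ {n i : ℕ} (h : i < n) : Real.logb 2 (n.choose (i + 1))
    = Real.logb 2 (n.choose i) + Real.logb 2 (((n : ℝ) - i) / (i + 1)) := by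
  have h0 : (n.choose i : ℝ) ≠ 0 := by exact_mod_cast (Nat.choose_pos h.le).ne'
  have h1 : (0 : ℝ) < (n : ℝ) - i := sub_pos.2 (by exact_mod_cast h)
  rw [← Real.logb_mul h0 (by positivity)]
  congr 1
  have := Nat.choose_succ_right_eq n i
  have e : ((n.choose (i + 1) : ℝ)) * (i + 1) = n.choose i * ((n : ℝ) - i) := by
    rw [← Nat.cast_sub h.le]
    exact_mod_cast this
  field_simp
  linarith

/-- The increments of log C(n, ·) decrease (log-concavity), so the next increment is at most the
average of the preceding ones. -/
lemma mul_logb_le_logb_choose {n i : ℕ} (h : i < n) :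
    i * Real.logb 2 (((n : ℝ) - i) / (i + 1)) ≤ Real.logb 2 (n.choose i) := by
  induction i with
  | zero => simp
  | succ i ih =>
    have h1 := ih (by omega)
    rw [logb_choose_succ (by omega)]
    have hn : (i : ℝ) + 1 < n := by exact_mod_cast h
    have h2 : Real.logb 2 (((n : ℝ) - (i + 1 : ℕ)) / ((i + 1 : ℕ) + 1))
        ≤ Real.logb 2 (((n : ℝ) - i) / (i + 1)) := by
      apply Real.logb_le_logb_of_le (by norm_num)
      · push_cast
        exact div_pos (by linarith) (by positivity)
      · push_cast
        rw [div_le_div_iff₀ (by positivity) (by positivity)]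
        nlinarith
    have h3 : ((i + 1 : ℕ) : ℝ) * Real.logb 2 (((n : ℝ) - (i + 1 : ℕ)) / ((i + 1 : ℕ) + 1))
        ≤ ((i + 1 : ℕ) : ℝ) * Real.logb 2 (((n : ℝ) - i) / (i + 1)) :=
      mul_le_mul_of_nonneg_left h2 (Nat.cast_nonneg _)
    have h4 : ((i + 1 : ℕ) : ℝ) * Real.logb 2 (((n : ℝ) - i) / (i + 1))
        = i * Real.logb 2 (((n : ℝ) - i) / (i + 1)) + Real.logb 2 (((n : ℝ) - i) / (i + 1)) := by
      push_cast
      ring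
    linarith

/-- log C(n,i)/i is an average of the first i decreasing increments, hence non-increasing in i. It
allows entropies at level i to be compared with the fraction i/m of log C(n,m). -/
lemma mul_logb_choose_le {n i m : ℕ} (him : i ≤ m) (hmn : m ≤ n) :
    i * Real.logb 2 (n.choose m) ≤ m * Real.logb 2 (n.choose i) := by
  induction m, him using Nat.le_induction with
  | base => exact le_rfl
  | succ m him ih =>
    rcases Nat.eq_zero_or_pos i with h0 | h0
    · simp [h0]
    · have h1 := ih (by omega)
      have h2 := mul_logb_le_logb_choose (n := n) (i := m) (by omega)
      rw [logb_choose_succ (by omega)]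
      set G := Real.logb 2 (n.choose m)
      set D := Real.logb 2 (((n : ℝ) - m) / (m + 1))
      set g := Real.logb 2 (n.choose i)
      have hm : (0 : ℝ) < m := by exact_mod_cast (by omega : 0 < m)
      have hi : (0 : ℝ) < i := by exact_mod_cast h0
      refine le_of_mul_le_mul_left ?_ hm
      push_cast
      nlinarith [mul_le_mul_of_nonneg_left h2 hi.le]

/-! ### Counting sets by inclusion, disjointness and intersection. -/

lemma sum_KSet {M : Type*} [AddCommMonoid M] {n k : ℕ} (f : Finset (Fin n) → M) :
    ∑ S : KSet n k, f S.1 = ∑ S ∈ Finset.powersetCard k Finset.univ, f S :=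
  (Finset.sum_subtype _ (fun x => by simp) f).symm

lemma sum_KSet_disjoint {n j : ℕ} (U : Finset (Fin n)) :
    ∑ R : KSet n j, (if Disjoint U R.1 then (1 : ℝ) else 0) = (n - U.card).choose j := by
  rw [sum_KSet fun R => if Disjoint U R then (1 : ℝ) else 0, Finset.sum_boole]
  have : Finset.filter (fun R => Disjoint U R) (Finset.powersetCard j Finset.univ)
      = Finset.powersetCard j Uᶜ := by
    ext R
    simp only [Finset.mem_filter, Finset.mem_powersetCard, Finset.subset_univ, true_and]
    rw [Finset.subset_compl_iff_disjoint_left, and_comm]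
  rw [this, Finset.card_powersetCard, Finset.card_compl, Fintype.card_fin]

lemma sum_KSet_superset {n j : ℕ} (U : Finset (Fin n)) (h : U.card ≤ j) :
    ∑ R : KSet n j, (if U ⊆ R.1 then (1 : ℝ) else 0) = (n - U.card).choose (j - U.card) := by
  rw [sum_KSet fun R => if U ⊆ R then (1 : ℝ) else 0, Finset.sum_boole,
    Finset.card_filter_powersetCard_subset _ _ _ (Finset.subset_univ U) h, Finset.card_univ,
    Fintype.card_fin]

lemma sum_KSet_subset {n i : ℕ} (U : Finset (Fin n)) :
    ∑ Q : KSet n i, (if Q.1 ⊆ U then (1 : ℝ) else 0) = U.card.choose i := by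
  rw [sum_KSet fun Q => if Q ⊆ U then (1 : ℝ) else 0, Finset.sum_boole]
  have : Finset.filter (fun R => R ⊆ U) (Finset.powersetCard i Finset.univ)
      = Finset.powersetCard i U := by
    ext R
    simp only [Finset.mem_filter, Finset.mem_powersetCard, Finset.subset_univ, true_and]
    rw [and_comm]
  rw [this, Finset.card_powersetCard]

/-- An i-subset of R ∩ R' takes s elements from R \ Q and i - s from Q. For each choice U of the
former, the remaining sum counts the sets R' that contain Q ∪ U. -/
lemma sum_superset_mul_choose_inter {n j i : ℕ} (hij : i ≤ j) {R Q : Finset (Fin n)}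
    (hR : R.card = j) (hQ : Q ∈ Finset.powersetCard i R) :
    ∑ R' : KSet n j, (if Q ⊆ R'.1 then ((R ∩ R'.1).card.choose i : ℝ) else 0)
      = ∑ s ∈ Finset.range (i + 1),
        ((i.choose s * ((j - i).choose s * (n - i - s).choose (j - i - s)) : ℕ) : ℝ) := by
  rw [Finset.mem_powersetCard] at hQ
  obtain ⟨hQR, hQi⟩ := hQ
  have hRQ : (R \ Q).card = j - i := by rw [Finset.card_sdiff_of_subset hQR, hR, hQi]
  have inner : ∀ R' : KSet n j, (if Q ⊆ R'.1 then ((R ∩ R'.1).card.choose i : ℝ) else 0)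
      = ∑ s ∈ Finset.range (i + 1), (i.choose s : ℝ) *
        ∑ U ∈ Finset.powersetCard s (R \ Q), (if Q ∪ U ⊆ R'.1 then (1 : ℝ) else 0) := by
    intro R'
    by_cases h : Q ⊆ R'.1
    · have hc : (R ∩ R'.1).card = ((R \ Q) ∩ R'.1).card + i := by
        rw [← hQi, ← Finset.card_sdiff_add_card_eq_card (Finset.subset_inter hQR h)]
        congr 2
        ext x
        simp only [Finset.mem_sdiff, Finset.mem_inter]
        tauto
      rw [if_pos h, hc, Nat.add_choose_eq, Finset.Nat.sum_antidiagonal_eq_sum_range_succ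
        (fun a b => ((R \ Q) ∩ R'.1).card.choose a * i.choose b)]
      push_cast
      refine Finset.sum_congr rfl fun s hs => ?_
      rw [Finset.mem_range] at hs
      rw [Nat.choose_symm (by omega), mul_comm]
      congr 1
      have : ∀ U : Finset (Fin n), (Q ∪ U ⊆ R'.1) ↔ U ⊆ R'.1 := fun U => by
        rw [Finset.union_subset_iff]
        exact and_iff_right h
      simp only [this]
      rw [Finset.sum_boole, ← Finset.card_powersetCard]
      congr 2
      ext U
      simp only [Finset.mem_powersetCard, Finset.mem_filter, Finset.subset_inter_iff]
      tauto
    · rw [if_neg h, Finset.sum_eq_zero]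
      intro s _
      rw [Finset.sum_eq_zero, mul_zero]
      intro U _
      rw [if_neg fun hU => h (Finset.union_subset_left hU)]
  simp_rw [inner]
  rw [Finset.sum_comm]
  refine Finset.sum_congr rfl fun s _ => ?_
  rw [← Finset.mul_sum, Finset.sum_comm]
  have h2 : ∀ U ∈ Finset.powersetCard s (R \ Q),
      ∑ R' : KSet n j, (if Q ∪ U ⊆ R'.1 then (1 : ℝ) else 0)
        = (n - i - s).choose (j - i - s) := by
    intro U hU
    rw [Finset.mem_powersetCard] at hU
    have hd : Disjoint Q U := Finset.disjoint_of_subset_right hU.1 Finset.disjoint_sdiff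
    have hc : (Q ∪ U).card = i + s := by rw [Finset.card_union_of_disjoint hd, hQi, hU.2]
    have hs : s ≤ j - i := by
      rw [← hRQ, ← hU.2]
      exact Finset.card_le_card hU.1
    rw [sum_KSet_superset _ (by omega), hc, Nat.sub_sub, Nat.sub_sub]
  rw [Finset.sum_congr rfl h2, Finset.sum_const, Finset.card_powersetCard, hRQ, nsmul_eq_mul]
  push_cast
  ring

/-- One factor of the square is read as the choice of an i-set Q ⊆ R ∩ R'; exchanging the sums
leaves a count that is the same for every Q ⊆ R. The bound controls the purity of `supersetState`.
-/
lemma sum_choose_inter_sq_le {n j i : ℕ} (hij : i ≤ j) (hn : 10 * j ≤ n) (R : KSet n j) :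
    ∑ R' : KSet n j, ((R.1 ∩ R'.1).card.choose i : ℝ) ^ 2
      ≤ j.choose i * (2 ^ (j - i) * (n - i).choose (j - i)) := by
  have e : ∀ R' : KSet n j, ((R.1 ∩ R'.1).card.choose i : ℝ) ^ 2
      = ∑ Q ∈ Finset.powersetCard i R.1,
        (if Q ⊆ R'.1 then ((R.1 ∩ R'.1).card.choose i : ℝ) else 0) := by
    intro R'
    rw [← Finset.sum_filter, Finset.sum_const, nsmul_eq_mul, sq]
    congr 1
    rw [← Finset.card_powersetCard]
    congr 2
    ext U
    simp only [Finset.mem_powersetCard, Finset.mem_filter, Finset.subset_inter_iff]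
    tauto
  simp_rw [e]
  rw [Finset.sum_comm, Finset.sum_congr rfl fun Q hQ => sum_superset_mul_choose_inter hij R.2 hQ,
    Finset.sum_const, Finset.card_powersetCard, R.2, nsmul_eq_mul]
  exact mul_le_mul_of_nonneg_left (sum_choose_mul_choose_mul_choose_le (by omega))
    (Nat.cast_nonneg _)

/-! ### Superset and disjointness states, and the first entropy bound for the samples. -/

/-- The uniform mixture, over `i`-sets `Q`, of the pure states that are uniform superpositions of
the `j`-sets that contain `Q`. -/
def supersetState (n j i : ℕ) : Matrix (KSet n j) (KSet n j) ℂ :=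
  Matrix.of fun R R' =>
    (((R.1 ∩ R'.1).card.choose i / (j.choose i * n.choose j) : ℝ) : ℂ)

lemma supersetState_posSemidef (n j i : ℕ) : (supersetState n j i).PosSemidef := by
  have : supersetState n j i = ((1 / (j.choose i * n.choose j) : ℝ) : ℂ) •
      ((Matrix.of fun (R : KSet n j) (Q : KSet n i) => if Q.1 ⊆ R.1 then (1 : ℂ) else 0) *
      (Matrix.of fun (R : KSet n j) (Q : KSet n i) =>
        if Q.1 ⊆ R.1 then (1 : ℂ) else 0).conjTranspose) := by
    ext R R'
    simp only [supersetState, Matrix.of_apply, Matrix.smul_apply, Matrix.mul_apply,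
      Matrix.conjTranspose_apply]
    have h := congrArg Complex.ofReal (sum_KSet_subset (i := i) (R.1 ∩ R'.1))
    rw [Complex.ofReal_natCast] at h
    have h2 : ∑ Q : KSet n i, (if Q.1 ⊆ R.1 then (1 : ℂ) else 0) *
        star (if Q.1 ⊆ R'.1 then (1 : ℂ) else 0) = ((R.1 ∩ R'.1).card.choose i : ℂ) := by
      rw [← h, Complex.ofReal_sum]
      refine Finset.sum_congr rfl fun Q _ => ?_
      simp only [Finset.subset_inter_iff]
      by_cases h1 : Q.1 ⊆ R.1 <;> by_cases h2 : Q.1 ⊆ R'.1 <;> simp [h1, h2]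
    rw [h2]
    push_cast
    rw [smul_eq_mul]
    ring
  rw [this]
  refine (Matrix.posSemidef_self_mul_conjTranspose _).smul ?_
  have : (0 : ℝ) ≤ 1 / (j.choose i * n.choose j) := by positivity
  exact_mod_cast this

/-- A mixture of C(n,i) orthogonal states would have purity 1/C(n,i). The overlaps of superpositions
of supersets cost at most a factor 2^(j-i), that is, j - i bits. -/
lemma vnEntropy_supersetState_ge {n j i : ℕ} (hij : i ≤ j) (hn : 10 * j ≤ n) :
    Real.logb 2 (n.choose i) - ((j : ℝ) - i) ≤ vnEntropy (supersetState n j i) := by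
  have c1 : (0 : ℝ) < j.choose i := by exact_mod_cast Nat.choose_pos hij
  have c2 : (0 : ℝ) < n.choose j := by exact_mod_cast Nat.choose_pos (by omega)
  have c3 : (0 : ℝ) < n.choose i := by exact_mod_cast Nat.choose_pos (by omega)
  have htr : (supersetState n j i).trace = 1 := by
    have : ∀ R : KSet n j, supersetState n j i R R = ((1 / (n.choose j) : ℝ) : ℂ) := by
      intro R
      rw [supersetState, Matrix.of_apply, Finset.inter_self, R.2]
      congr 1
      field_simp
    simp only [Matrix.trace, Matrix.diag_apply, this, Finset.sum_const, Finset.card_univ,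
      card_KSet, nsmul_eq_mul]
    rw [← Complex.ofReal_natCast, ← Complex.ofReal_mul, mul_one_div_cancel c2.ne',
      Complex.ofReal_one]
  have hP : (Matrix.trace (supersetState n j i * supersetState n j i)).re
      ≤ 2 ^ (j - i) / n.choose i := by
    have e : Matrix.trace (supersetState n j i * supersetState n j i)
        = ((∑ R : KSet n j, (∑ R' : KSet n j, ((R.1 ∩ R'.1).card.choose i : ℝ) ^ 2) /
          (j.choose i * n.choose j) ^ 2 : ℝ) : ℂ) := by
      simp only [Matrix.trace, Matrix.diag_apply, Matrix.mul_apply, supersetState, Matrix.of_apply]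
      rw [Complex.ofReal_sum]
      refine Finset.sum_congr rfl fun R _ => ?_
      rw [Finset.sum_div, Complex.ofReal_sum]
      refine Finset.sum_congr rfl fun R' _ => ?_
      rw [Finset.inter_comm R'.1, ← Complex.ofReal_mul]
      congr 1
      ring
    rw [e, Complex.ofReal_re]
    calc _ ≤ ∑ R : KSet n j, (j.choose i * (2 ^ (j - i) * (n - i).choose (j - i)) : ℝ) /
          (j.choose i * n.choose j) ^ 2 :=
          Finset.sum_le_sum fun R _ =>
            div_le_div_of_nonneg_right (sum_choose_inter_sq_le hij hn R) (by positivity)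
      _ = n.choose j * ((j.choose i * (2 ^ (j - i) * (n - i).choose (j - i)) : ℝ) /
          (j.choose i * n.choose j) ^ 2) := by
          rw [Finset.sum_const, Finset.card_univ, card_KSet, nsmul_eq_mul]
      _ = 2 ^ (j - i) / n.choose i := by
          have h := Nat.choose_mul (n := n) hij
          have h' : (n.choose j : ℝ) * j.choose i = n.choose i * (n - i).choose (j - i) := by
            exact_mod_cast h
          rw [← mul_div_assoc, div_eq_div_iff (by positivity) (by positivity)]
          linear_combination (-(2 : ℝ) ^ (j - i) * n.choose j * j.choose i) * h'
  have := neg_logb_le_vnEntropy (supersetState_posSemidef n j i) htr (by positivity) hP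
  rw [Real.logb_div (by positivity) c3.ne', Real.logb_pow, Real.logb_self_eq_one (by norm_num),
    Nat.cast_sub hij] at this
  linarith

/-- The uniform mixture, over `j`-sets `R`, of the pure states that are uniform superpositions of
the `k`-sets disjoint from `R`. -/
def disjointState (n k j : ℕ) : Matrix (KSet n k) (KSet n k) ℂ :=
  Matrix.of fun S T =>
    (((n - (S.1 ∪ T.1).card).choose j / ((n - k).choose j * n.choose k) : ℝ) : ℂ)

/-- Both sides count pairs of a disjoint k-set and j-set. -/
lemma choose_mul_choose_sub_comm (n k j : ℕ) :
    n.choose k * (n - k).choose j = n.choose j * (n - j).choose k := by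
  have h1 := Nat.choose_mul (n := n) (Nat.le_add_left k j)
  have h2 := Nat.choose_mul (n := n) (Nat.le_add_right j k)
  rw [Nat.add_sub_cancel] at h1
  rw [Nat.add_sub_cancel_left] at h2
  rw [← h1, ← h2, Nat.choose_symm_add]

/-- The matrix of disjointness of `k`-sets and `j`-sets, normalized. -/
def disjointMatrix (n k j : ℕ) : Matrix (KSet n k) (KSet n j) ℂ :=
  Matrix.of fun S R => if Disjoint S.1 R.1 then
    ((1 / Real.sqrt ((n - k).choose j * n.choose k) : ℝ) : ℂ) else 0

lemma disjointMatrix_mul_conjTranspose (n k j : ℕ) :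
    disjointMatrix n k j * (disjointMatrix n k j).conjTranspose = disjointState n k j := by
  ext S T
  simp only [disjointMatrix, disjointState, Matrix.mul_apply, Matrix.conjTranspose_apply,
    Matrix.of_apply]
  rw [← sum_KSet_disjoint, Finset.sum_div, Complex.ofReal_sum]
  refine Finset.sum_congr rfl fun R _ => ?_
  simp only [Finset.disjoint_union_left]
  by_cases h1 : Disjoint S.1 R.1 <;> by_cases h2 : Disjoint T.1 R.1
  · rw [if_pos h1, if_pos h2, if_pos ⟨h1, h2⟩, Complex.star_def, Complex.conj_ofReal,
      ← Complex.ofReal_mul, div_mul_div_comm, Real.mul_self_sqrt (by positivity), one_mul]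
  all_goals simp [h1, h2]

lemma conjTranspose_disjointMatrix (n k j : ℕ) :
    (disjointMatrix n k j).conjTranspose = disjointMatrix n j k := by
  ext S T
  simp only [disjointMatrix, Matrix.conjTranspose_apply, Matrix.of_apply, disjoint_comm,
    apply_ite (star : ℂ → ℂ), star_zero]
  have h : ((n - k).choose j * n.choose k : ℝ) = (n - j).choose k * n.choose j := by
    rw [mul_comm, mul_comm ((n - j).choose k : ℝ)]
    exact_mod_cast choose_mul_choose_sub_comm n k j
  rw [h, Complex.star_def, Complex.conj_ofReal]

/-- Exchanges k-sets for the smaller j-sets, where the expansion into superset states is available.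
-/
lemma vnEntropy_disjointState_comm (n k j : ℕ) :
    vnEntropy (disjointState n k j) = vnEntropy (disjointState n j k) := by
  rw [← disjointMatrix_mul_conjTranspose, vnEntropy_mul_conjTranspose_comm,
    ← disjointMatrix_mul_conjTranspose n j k, conjTranspose_disjointMatrix,
    conjTranspose_disjointMatrix]

lemma disjointState_posSemidef (n k j : ℕ) : (disjointState n k j).PosSemidef := by
  rw [← disjointMatrix_mul_conjTranspose]
  exact Matrix.posSemidef_self_mul_conjTranspose _

lemma sum_hypergeometric {n k j : ℕ} (hjk : j ≤ k) (hjn : j + k ≤ n) (h2 : 2 * j ≤ n) :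
    ∑ i ∈ Finset.range (j + 1),
      ((j.choose i * (n - 2 * j).choose (k - i) / (n - j).choose k : ℝ)) = 1 := by
  have h := sum_choose_mul_choose hjk le_rfl (n - 2 * j)
  rw [show j + (n - 2 * j) = n - j by omega] at h
  have hp : (0 : ℝ) < (n - j).choose k := by exact_mod_cast Nat.choose_pos (by omega)
  rw [← Finset.sum_div, div_eq_one_iff_eq hp.ne']
  exact_mod_cast h

/-- For k draws without replacement from n - j elements, j of them marked, the mean number of missed
marked elements is j(n-j-k)/(n-j) ≤ j(n-k)/n. With k = n - m this is the small loss jm/n. -/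
lemma sum_hypergeometric_mul_le {n k j : ℕ} (hjk : j ≤ k) (hjn : j + k ≤ n) (h2 : 2 * j ≤ n) :
    ∑ i ∈ Finset.range (j + 1),
      (j.choose i * (n - 2 * j).choose (k - i) / (n - j).choose k : ℝ) * ((j : ℝ) - i)
      ≤ j * ((n : ℝ) - k) / n := by
  have hkn : (k : ℝ) ≤ n := by exact_mod_cast (by omega : k ≤ n)
  rcases Nat.eq_zero_or_pos j with rfl | hj
  · simp
  have h := sum_choose_mul_choose hjk (Nat.sub_le j 1) (n - 2 * j)
  have hp : (0 : ℝ) < (n - j).choose k := by exact_mod_cast Nat.choose_pos (by omega)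
  have e1 : ∀ i ∈ Finset.range (j + 1),
      (j.choose i * (n - 2 * j).choose (k - i) / (n - j).choose k : ℝ) * ((j : ℝ) - i)
      = j / (n - j).choose k * (((j - 1).choose i * (n - 2 * j).choose (k - i) : ℕ) : ℝ) := by
    intro i hi
    rw [Finset.mem_range] at hi
    have h3 := Nat.choose_mul_succ_eq (j - 1) i
    rw [Nat.sub_add_cancel hj] at h3
    have h4 : ((j - 1).choose i : ℝ) * j = j.choose i * ((j : ℝ) - i) := by
      rw [← Nat.cast_sub (by omega : i ≤ j)]
      exact_mod_cast h3
    push_cast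
    rw [div_mul_eq_mul_div, div_mul_eq_mul_div]
    congr 1
    linear_combination (-((n - 2 * j).choose (k - i) : ℝ)) * h4
  rw [Finset.sum_congr rfl e1, ← Finset.mul_sum, ← Nat.cast_sum, h]
  have h5 := Nat.choose_mul_succ_eq (n - j - 1) k
  rw [show n - j - 1 + 1 = n - j by omega] at h5
  rw [show j - 1 + (n - 2 * j) = n - j - 1 by omega]
  have h6 : ((n - j - 1).choose k : ℝ) * ((n : ℝ) - j)
      = (n - j).choose k * ((n : ℝ) - j - k) := by
    rw [← Nat.cast_sub (by omega : j ≤ n), ← Nat.cast_sub (by omega : k ≤ n - j)]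
    exact_mod_cast h5
  have hnj : (0 : ℝ) < (n : ℝ) - j := sub_pos.2 (by exact_mod_cast (by omega : j < n))
  have hn0 : (0 : ℝ) < n := by exact_mod_cast (by omega : 0 < n)
  have h7 : (j : ℝ) / (n - j).choose k * ((n - j - 1).choose k : ℝ)
      = j * (((n : ℝ) - j - k) / ((n : ℝ) - j)) := by
    field_simp
    linarith
  rw [h7, mul_div_assoc]
  refine mul_le_mul_of_nonneg_left ?_ (Nat.cast_nonneg _)
  rw [div_le_div_iff₀ hnj hn0]
  nlinarith [(Nat.cast_nonneg j : (0 : ℝ) ≤ j), (Nat.cast_nonneg k : (0 : ℝ) ≤ k)]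

/-- The outside of R ∪ R' has |R ∩ R'| + (n - 2j) elements, and Vandermonde's identity expands its
k-sets in the kernels C(|R ∩ R'|, i). -/
lemma disjointState_eq_sum {n k j : ℕ} (hjk : j ≤ k) (h2 : 2 * j ≤ n) :
    disjointState n j k = ∑ i ∈ Finset.range (j + 1),
      ((j.choose i * (n - 2 * j).choose (k - i) / (n - j).choose k : ℝ) : ℂ) •
        supersetState n j i := by
  ext R R'
  rw [Matrix.sum_apply]
  simp only [disjointState, supersetState, Matrix.of_apply, Matrix.smul_apply, smul_eq_mul]
  simp only [← Complex.ofReal_mul, ← Complex.ofReal_sum]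
  congr 1
  have hy : (R.1 ∩ R'.1).card ≤ j := by
    have := Finset.card_le_card (Finset.inter_subset_left (s₁ := R.1) (s₂ := R'.1))
    rwa [R.2] at this
  have hu := Finset.card_union_add_card_inter R.1 R'.1
  rw [R.2, R'.2] at hu
  rw [show n - (R.1 ∪ R'.1).card = (R.1 ∩ R'.1).card + (n - 2 * j) by omega,
    ← sum_choose_mul_choose hjk hy, Nat.cast_sum, Finset.sum_div]
  refine Finset.sum_congr rfl fun i hi => ?_
  rw [Finset.mem_range] at hi
  have hp : (0 : ℝ) < j.choose i := by exact_mod_cast Nat.choose_pos (by omega)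
  push_cast
  field_simp

lemma vnEntropy_disjointState_ge {n m j : ℕ} (hj : j ≤ m) (hm : 0 < m) (hmn : 10 * m ≤ n) :
    (j : ℝ) * ((1 - m / n) * (Real.logb 2 (n.choose m) / m) - m / n)
      ≤ vnEntropy (disjointState n (n - m) j) := by
  set L := Real.logb 2 (n.choose m) with hL
  have hm' : (0 : ℝ) < m := by exact_mod_cast hm
  have hL0 : 0 ≤ L := Real.logb_nonneg (by norm_num)
    (by exact_mod_cast Nat.choose_pos (by omega : m ≤ n))
  rw [vnEntropy_disjointState_comm, disjointState_eq_sum (by omega) (by omega)]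
  refine le_trans ?_ (sum_mul_vnEntropy_le _ _ _ (fun i _ => by positivity)
    (sum_hypergeometric (by omega) (by omega) (by omega))
    fun i _ => supersetState_posSemidef n j i)
  have h1 : ∀ i ∈ Finset.range (j + 1),
      (j.choose i * (n - 2 * j).choose (n - m - i) / (n - j).choose (n - m) : ℝ) * (j * (L / m))
      - (j.choose i * (n - 2 * j).choose (n - m - i) / (n - j).choose (n - m) : ℝ) * ((j : ℝ) - i)
        * (L / m + 1)
      ≤ (j.choose i * (n - 2 * j).choose (n - m - i) / (n - j).choose (n - m) : ℝ)
        * vnEntropy (supersetState n j i) := by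
    intro i hi
    rw [Finset.mem_range] at hi
    rw [mul_assoc, ← mul_sub]
    refine mul_le_mul_of_nonneg_left ?_ (by positivity)
    refine le_trans ?_ (vnEntropy_supersetState_ge (by omega) (by omega))
    have h2 := mul_logb_choose_le (n := n) (i := i) (m := m) (by omega) (by omega)
    have h3 : i * (L / m) ≤ Real.logb 2 (n.choose i) := by
      rw [← mul_div_assoc, div_le_iff₀ hm']
      linarith
    linarith
  refine le_trans ?_ (Finset.sum_le_sum h1)
  rw [Finset.sum_sub_distrib, ← Finset.sum_mul, ← Finset.sum_mul,
    sum_hypergeometric (by omega) (by omega) (by omega)]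
  have h4 := sum_hypergeometric_mul_le (n := n) (k := n - m) (j := j)
    (by omega) (by omega) (by omega)
  rw [Nat.cast_sub (by omega : m ≤ n), sub_sub_cancel] at h4
  have h5 := mul_le_mul_of_nonneg_right h4 (by positivity : 0 ≤ L / m + 1)
  refine le_trans (le_of_eq ?_) (sub_le_sub_left h5 _)
  field_simp
  ring

/-- With x elements outside S ∪ T one has |S ∩ T| = k - m + x, so the Gram entry is the power that
the coupon weights expand, and C(x,j) counts the j-sets disjoint from both. -/
lemma gram_eq_sum {n m t : ℕ} (h2 : 2 * m ≤ n) {q : ℕ → ℝ}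
    (hq : ∀ x ≤ m, ∑ j ∈ Finset.range (m + 1), q j * ((x.choose j : ℝ) / m.choose j)
        = ((((n - m : ℕ) : ℝ) - m + x) / ((n - m : ℕ) : ℝ)) ^ t) :
    gram n (n - m) t = ∑ j ∈ Finset.range (m + 1), (q j : ℂ) • disjointState n (n - m) j := by
  ext S T
  rw [Matrix.sum_apply]
  simp only [disjointState, gram, Matrix.of_apply, Matrix.smul_apply, smul_eq_mul]
  simp only [← Complex.ofReal_mul, ← Complex.ofReal_sum]
  congr 1
  have hu := Finset.card_union_add_card_inter S.1 T.1
  have hS := Finset.card_le_card (Finset.subset_union_left (s₁ := S.1) (s₂ := T.1))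
  have hU := Finset.card_le_univ (S.1 ∪ T.1)
  rw [Fintype.card_fin] at hU
  rw [S.2] at hS
  rw [S.2, T.2] at hu
  set x := n - (S.1 ∪ T.1).card with hx
  have h3 : ((S.1 ∩ T.1).card : ℝ) = ((n - m : ℕ) : ℝ) - m + x := by
    have : (S.1 ∩ T.1).card + m = (n - m) + x := by omega
    have : ((S.1 ∩ T.1).card : ℝ) + m = ((n - m : ℕ) : ℝ) + x := by exact_mod_cast this
    linarith
  rw [h3, ← hq x (by omega), Finset.mul_sum]
  refine Finset.sum_congr rfl fun j _ => ?_
  rw [show n - (n - m) = m by omega]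
  rw [mul_comm (m.choose j : ℝ), ← div_div]
  ring

/-- Lower bound on the Holevo information in terms of the expected fraction of missing coupons. -/
lemma vnEntropy_stateB_ge {n m : ℕ} (t : ℕ) (hm : 0 < m) (hmn : 10 * m ≤ n) :
    (1 - (1 - 1 / ((n - m : ℕ) : ℝ)) ^ t) *
      ((1 - m / n) * Real.logb 2 (n.choose m) - m / n * m)
      ≤ vnEntropy (stateB n (n - m) t) := by
  obtain ⟨q, h0, h1, h2, h3⟩ :=
    exists_coupon_weights (m := m) (k := n - m) (by omega) (by omega) t
  have hm' : (m : ℝ) ≠ 0 := by exact_mod_cast hm.ne'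
  rw [vnEntropy_stateB, gram_eq_sum (by omega) h3]
  refine le_trans ?_ (sum_mul_vnEntropy_le _ _ _ h0 h1
    fun j _ => disjointState_posSemidef n (n - m) j)
  refine le_trans ?_ (Finset.sum_le_sum fun j hj => mul_le_mul_of_nonneg_left
    (vnEntropy_disjointState_ge (j := j) (by rw [Finset.mem_range] at hj; omega) hm hmn) (h0 j hj))
  -- The bound for each j is linear in j, so only the mean of the coupon weights enters.
  simp_rw [← mul_assoc]
  rw [← Finset.sum_mul, h2]
  apply le_of_eq
  field_simp

/-! ### Explicit bounds on the Holevo information. -/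

lemma mul_logb_le_logb_choose_of_le {n m : ℕ} (hm : 0 < m) {c : ℝ} (hc : 0 < c)
    (h : (c + 1) * m ≤ n) : m * Real.logb 2 c ≤ Real.logb 2 (n.choose m) := by
  obtain ⟨i, rfl⟩ : ∃ i, m = i + 1 := ⟨m - 1, by omega⟩
  have hmn : i + 1 < n := by
    have : ((i + 1 : ℕ) : ℝ) < n := by
      have : (0 : ℝ) < c * ((i + 1 : ℕ) : ℝ) := by positivity
      linarith
    exact_mod_cast this
  rw [logb_choose_succ (by omega)]
  have h1 := mul_logb_le_logb_choose (n := n) (i := i) (by omega)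
  push_cast at h ⊢
  have h2 : Real.logb 2 c ≤ Real.logb 2 (((n : ℝ) - i) / (i + 1)) := by
    apply Real.logb_le_logb_of_le (by norm_num) hc
    rw [le_div_iff₀ (by positivity)]
    linarith
  have h3 := mul_le_mul_of_nonneg_left h2 (by positivity : (0 : ℝ) ≤ (i : ℝ) + 1)
  linarith

lemma logb_choose_nonneg {n m : ℕ} (h : m ≤ n) : 0 ≤ Real.logb 2 (n.choose m) :=
  Real.logb_nonneg (by norm_num) (by exact_mod_cast Nat.choose_pos h)

lemma one_sub_inv_pow_le (k t : ℕ) (hk : 0 < k) :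
    (1 - 1 / (k : ℝ)) ^ t ≤ Real.exp (-(t / k)) := by
  have h1 : (1 : ℝ) ≤ k := by exact_mod_cast hk
  have h2 : (0 : ℝ) ≤ 1 - 1 / (k : ℝ) := by
    rw [sub_nonneg, div_le_one (by linarith)]
    exact h1
  calc (1 - 1 / (k : ℝ)) ^ t ≤ (Real.exp (-(1 / k))) ^ t := by
        gcongr
        have := Real.add_one_le_exp (-(1 / (k : ℝ)))
        linarith
    _ = _ := by
        rw [← Real.exp_nat_mul]
        congr 1
        ring

/-- Here p stands for m/n. After e^(-κp) ≤ 1/(1+κp) everything reduces to `main`. It is trivial for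
κ ≥ 4/3; below, p = 1/10 is the worst case, and e^(-κ) ≥ (1-κ/2)² leaves a quadratic of negative
discriminant. -/
lemma one_sub_exp_sub_le {κ p : ℝ} (hκ : 0 ≤ κ) (hp : 0 ≤ p) (hp' : p ≤ 1 / 10) :
    1 - Real.exp (-κ) - κ * p ≤ (1 - Real.exp (-(κ * (1 + p)))) * (1 - 4 / 3 * p) := by
  have hκp : 0 ≤ κ * p := mul_nonneg hκ hp
  set E := Real.exp (-κ) with hE
  have hE0 : 0 < E := Real.exp_pos _
  have e1 : Real.exp (-(κ * (1 + p))) = E * Real.exp (-(κ * p)) := by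
    rw [hE, ← Real.exp_add]
    congr 1
    ring
  have e2 : Real.exp (-(κ * p)) ≤ 1 / (1 + κ * p) := by
    rw [Real.exp_neg, ← one_div]
    apply one_div_le_one_div_of_le (by positivity)
    linarith [Real.add_one_le_exp (κ * p)]
  have main : (4 / 3 - κ) * (1 + κ * p) ≤ E * (κ + 4 / 3) := by
    rcases le_or_gt (4 / 3) κ with h | h
    · have : (4 / 3 - κ) * (1 + κ * p) ≤ 0 :=
        mul_nonpos_of_nonpos_of_nonneg (by linarith) (by positivity)
      have : 0 ≤ E * (κ + 4 / 3) := by positivity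
      linarith
    · have h1 : (1 - κ / 2) ^ 2 ≤ E := by
        have : E = Real.exp (-κ / 2) ^ 2 := by
          rw [hE, ← Real.exp_nat_mul]
          congr 1
          push_cast
          ring
        rw [this]
        have := Real.add_one_le_exp (-κ / 2)
        exact pow_le_pow_left₀ (by linarith) (by linarith) 2
      have h2 : (1 - κ / 2) ^ 2 * (κ + 4 / 3) ≤ E * (κ + 4 / 3) :=
        mul_le_mul_of_nonneg_right h1 (by linarith)
      have h3 : (4 / 3 - κ) * (1 + κ * p) ≤ (4 / 3 - κ) * (1 + κ * (1 / 10)) := by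
        have := mul_le_mul_of_nonneg_left hp' hκ
        exact mul_le_mul_of_nonneg_left (by linarith) (by linarith)
      have h4 : (1 - κ / 2) ^ 2 * (κ + 4 / 3) - (4 / 3 - κ) * (1 + κ * (1 / 10))
          = κ * (8 / 15 - 17 / 30 * κ + κ ^ 2 / 4) := by ring
      have h5 : 0 ≤ κ * (8 / 15 - 17 / 30 * κ + κ ^ 2 / 4) :=
        mul_nonneg hκ (by nlinarith [sq_nonneg (κ - 17 / 15)])
      linarith
  have h6 : E * Real.exp (-(κ * p)) ≤ E * (1 / (1 + κ * p)) :=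
    mul_le_mul_of_nonneg_left e2 hE0.le
  rw [e1]
  have h7 : (1 - E * (1 / (1 + κ * p))) * (1 - 4 / 3 * p)
      ≤ (1 - E * Real.exp (-(κ * p))) * (1 - 4 / 3 * p) :=
    mul_le_mul_of_nonneg_right (by linarith) (by linarith)
  refine le_trans ?_ h7
  have h8 : (1 - E * (1 / (1 + κ * p))) * (1 - 4 / 3 * p) - (1 - E - κ * p)
      = p * (E * (κ + 4 / 3) - (4 / 3 - κ) * (1 + κ * p)) / (1 + κ * p) := by
    field_simp
    ring
  have h9 : 0 ≤ p * (E * (κ + 4 / 3) - (4 / 3 - κ) * (1 + κ * p)) / (1 + κ * p) :=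
    div_nonneg (mul_nonneg hp (by linarith)) (by positivity)
  linarith

/-- The Holevo information of `κ n` samples. -/
lemma vnEntropy_stateB_ge_of_eq_mul {n m t : ℕ} {κ : ℝ} (hm : 0 < m) (hmn : 10 * m ≤ n)
    (hκ : 0 ≤ κ) (ht : (t : ℝ) = κ * n) :
    (1 - Real.exp (-κ) - κ * m / n) * Real.logb 2 (n.choose m)
      ≤ vnEntropy (stateB n (n - m) t) := by
  refine le_trans ?_ (vnEntropy_stateB_ge t hm hmn)
  have hm' : (0 : ℝ) < m := by exact_mod_cast hm
  have hmn' : 10 * (m : ℝ) ≤ n := by exact_mod_cast hmn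
  have hn' : (0 : ℝ) < n := by linarith
  set L := Real.logb 2 (n.choose m) with hL
  set p : ℝ := m / n with hp
  have hp0 : 0 ≤ p := by positivity
  have hp1 : p ≤ 1 / 10 := by
    rw [hp, div_le_iff₀ hn']
    linarith
  -- From n ≥ 9m: the loss p m is then at most p L/3, which produces the factor 1 - (4/3)p.
  have hL3 : 3 * (m : ℝ) ≤ L := by
    have := mul_logb_le_logb_choose_of_le (n := n) (m := m) hm (c := 8) (by norm_num) (by linarith)
    rw [show (8 : ℝ) = 2 ^ 3 by norm_num, Real.logb_pow, Real.logb_self_eq_one (by norm_num)] at this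
    push_cast at this
    linarith
  -- Draws are from n - m coupons rather than n, and 1/(n-m) ≥ (1+p)/n. This gain helps to pay for
  -- the factor 1 - (4/3)p.
  have hθ : 1 - Real.exp (-(κ * (1 + p))) ≤ 1 - (1 - 1 / ((n - m : ℕ) : ℝ)) ^ t := by
    have h1 := one_sub_inv_pow_le (n - m) t (by omega)
    have h2 : Real.exp (-(t / (n - m : ℕ))) ≤ Real.exp (-(κ * (1 + p))) := by
      rw [Real.exp_le_exp, neg_le_neg_iff, Nat.cast_sub (by omega), ht, mul_div_assoc]
      refine mul_le_mul_of_nonneg_left ?_ hκ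
      rw [le_div_iff₀ (by linarith), hp]
      have : (1 + (m : ℝ) / n) * (n - m) = n - m * m / n := by
        field_simp
        ring
      rw [this]
      have : 0 ≤ (m : ℝ) * m / n := by positivity
      linarith
    linarith
  have hθ0 : 0 ≤ 1 - Real.exp (-(κ * (1 + p))) := by
    rw [sub_nonneg, Real.exp_le_one_iff]
    have : 0 ≤ κ * (1 + p) := by positivity
    linarith
  have h4 : (1 - 4 / 3 * p) * L ≤ (1 - p) * L - p * m := by
    nlinarith
  have h5 := one_sub_exp_sub_le hκ hp0 hp1
  have hL0 : 0 ≤ L := by linarith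
  calc (1 - Real.exp (-κ) - κ * m / n) * L = (1 - Real.exp (-κ) - κ * p) * L := by
        rw [hp, mul_div_assoc]
    _ ≤ (1 - Real.exp (-(κ * (1 + p)))) * (1 - 4 / 3 * p) * L :=
        mul_le_mul_of_nonneg_right h5 hL0
    _ = (1 - Real.exp (-(κ * (1 + p)))) * ((1 - 4 / 3 * p) * L) := by ring
    _ ≤ (1 - Real.exp (-(κ * (1 + p)))) * ((1 - p) * L - p * m) :=
        mul_le_mul_of_nonneg_left h4 hθ0
    _ ≤ _ := by
        refine mul_le_mul_of_nonneg_right hθ (le_trans ?_ h4)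
        exact mul_nonneg (by linarith) hL0

lemma ten_mul_le {η : ℝ} {n m : ℕ} (hη : η ≤ 1 / 10) (h : (m : ℝ) ≤ η * n) : 10 * m ≤ n := by
  have h1 := mul_le_mul_of_nonneg_right hη (Nat.cast_nonneg (α := ℝ) n)
  have : (10 : ℝ) * m ≤ n := by linarith
  exact_mod_cast this

/-- A large κ makes e^(-κ) at most ε/2, and then η, chosen after κ, makes κm/n at most ε/2. The κ +
1 in η absorbs the rounding up of κn. -/
lemma holevo_near_maximal (ε : ℝ) (hε : 0 < ε) : ∃ κ₀ : ℝ, 0 < κ₀ ∧ ∀ κ : ℝ, κ₀ ≤ κ →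
    ∃ η : ℝ, 0 < η ∧ η ≤ 1 / 10 ∧ ∀ n m : ℕ, 0 < m → (m : ℝ) ≤ η * n →
      (1 - ε) * Real.logb 2 (n.choose m) ≤ vnEntropy (stateB n (n - m) ⌈κ * n⌉₊) := by
  refine ⟨|Real.log (ε / 2)| + 1, by positivity, fun κ hκ => ?_⟩
  have hκ0 : 0 < κ := lt_of_lt_of_le (by positivity) hκ
  refine ⟨min (1 / 10) (ε / (2 * (κ + 1))), lt_min (by norm_num) (by positivity),
    min_le_left _ _, fun n m hm hmn => ?_⟩
  have hm' : (0 : ℝ) < m := by exact_mod_cast hm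
  have hn' : (0 : ℝ) < n := by
    by_contra h
    have h0 : (n : ℝ) = 0 := le_antisymm (not_lt.1 h) (Nat.cast_nonneg n)
    rw [h0, mul_zero] at hmn
    linarith
  have hn1 : (1 : ℝ) ≤ n := by exact_mod_cast (by exact_mod_cast hn' : 0 < n)
  have h10 : 10 * m ≤ n := ten_mul_le (min_le_left _ _) hmn
  set t := ⌈κ * n⌉₊ with ht
  have ht1 : κ * n ≤ t := Nat.le_ceil _
  have ht2 : (t : ℝ) < κ * n + 1 := Nat.ceil_lt_add_one (by positivity)
  have hκ1 : κ ≤ t / n := by rwa [le_div_iff₀ hn']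
  have hκ2 : (t : ℝ) / n ≤ κ + 1 := by
    rw [div_le_iff₀ hn']
    linarith
  refine le_trans ?_ (vnEntropy_stateB_ge_of_eq_mul (κ := t / n) hm h10 (by positivity)
    (by field_simp))
  refine mul_le_mul_of_nonneg_right ?_ (logb_choose_nonneg (by omega))
  have e1 : Real.exp (-(t / n : ℝ)) ≤ ε / 2 := by
    rw [← Real.exp_log (by positivity : 0 < ε / 2), Real.exp_le_exp]
    have := neg_abs_le (Real.log (ε / 2))
    linarith
  have e2 : (t : ℝ) / n * m / n ≤ ε / 2 := by
    rw [mul_div_assoc]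
    have h1 : (m : ℝ) / n ≤ ε / (2 * (κ + 1)) := by
      rw [div_le_iff₀ hn']
      exact hmn.trans (mul_le_mul_of_nonneg_right (min_le_right _ _) hn'.le)
    calc (t : ℝ) / n * (m / n) ≤ (κ + 1) * (ε / (2 * (κ + 1))) :=
          mul_le_mul hκ2 h1 (by positivity) (by positivity)
      _ = ε / 2 := by field_simp
  linarith

/-- With c = 10 the ratio t/n lies between 9 and 11, while n ≥ 10^6 gives m/n ≤ 1/1000; each of the
two error terms is then at most 1/20. -/
lemma holevo_sqrt_ge (n : ℕ) (hn : 1000000 ≤ n) :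
    9 / 10 * Real.logb 2 (n.choose n.sqrt)
      ≤ vnEntropy (stateB n (n - n.sqrt) (n / 2 + ⌈(10 : ℝ) * (n - n.sqrt : ℕ)⌉₊)) := by
  set m := n.sqrt with hm
  have hm1 : 1000 ≤ m := by
    rw [hm, Nat.le_sqrt]
    omega
  have hm2 : m * m ≤ n := Nat.sqrt_le n
  have hm3 : 1000 * m ≤ n := le_trans (Nat.mul_le_mul_right m hm1) hm2
  set t := n / 2 + ⌈(10 : ℝ) * (n - m : ℕ)⌉₊ with ht
  have hc : ⌈(10 : ℝ) * (n - m : ℕ)⌉₊ = 10 * (n - m) := by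
    rw [show (10 : ℝ) * (n - m : ℕ) = ((10 * (n - m) : ℕ) : ℝ) by push_cast; ring, Nat.ceil_natCast]
  have ht1 : 9 * n ≤ t := by omega
  have ht2 : t ≤ 11 * n := by omega
  have hn' : (0 : ℝ) < n := by exact_mod_cast (by omega : 0 < n)
  have hκ1 : (9 : ℝ) ≤ t / n := by
    rw [le_div_iff₀ hn']
    exact_mod_cast ht1
  have hκ2 : (t : ℝ) / n ≤ 11 := by
    rw [div_le_iff₀ hn']
    exact_mod_cast ht2
  refine le_trans ?_ (vnEntropy_stateB_ge_of_eq_mul (κ := t / n) (by omega) (by omega)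
    (by positivity) (by field_simp))
  refine mul_le_mul_of_nonneg_right ?_ (logb_choose_nonneg (by omega))
  have e1 : Real.exp (-(t / n : ℝ)) ≤ 1 / 20 := by
    have h1 : Real.exp (-(t / n : ℝ)) ≤ Real.exp (-(9 : ℝ)) := by
      rw [Real.exp_le_exp]
      linarith
    have h2 : Real.exp (-(9 : ℝ)) ≤ 1 / 512 := by
      have h3 : (512 : ℝ) ≤ Real.exp 9 := by
        have h4 := Real.add_one_le_exp (1 : ℝ)
        have h5 : Real.exp 9 = Real.exp 1 ^ 9 := by
          rw [← Real.exp_nat_mul]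
          norm_num
        rw [h5]
        calc (512 : ℝ) = 2 ^ 9 := by norm_num
          _ ≤ _ := pow_le_pow_left₀ (by norm_num) (by linarith) 9
      rw [Real.exp_neg, ← one_div]
      exact one_div_le_one_div_of_le (by norm_num) h3
    linarith
  have e2 : (t : ℝ) / n * m / n ≤ 1 / 20 := by
    rw [mul_div_assoc]
    have h1 : (m : ℝ) / n ≤ 1 / 1000 := by
      rw [div_le_iff₀ hn']
      have : (1000 : ℝ) * m ≤ n := by exact_mod_cast hm3
      linarith
    calc (t : ℝ) / n * (m / n) ≤ 11 * (1 / 1000) :=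
          mul_le_mul hκ2 h1 (by positivity) (by norm_num)
      _ ≤ _ := by norm_num
  linarith

/-! ### Learners and the verification of their output. -/

lemma samplesState_posSemidef {n k t : ℕ} (S : KSet n k) : (samplesState t S).PosSemidef :=
  Matrix.posSemidef_vecMulVec_self_star _

lemma trace_samplesState_mul {n k t : ℕ} (S T : KSet n k) :
    Matrix.trace (samplesState t S * samplesState t T)
      = (((((S.1 ∩ T.1).card / k : ℝ) ^ t) ^ 2 : ℝ) : ℂ) := by
  rw [Complex.ofReal_pow, sq, ← sum_samples_mul_samples, Finset.sum_mul_sum]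
  simp only [Matrix.trace, Matrix.diag_apply, Matrix.mul_apply, samplesState_apply]
  refine Finset.sum_congr rfl fun u _ => Finset.sum_congr rfl fun v _ => by ring

lemma trace_samplesState {n k t : ℕ} (hk : k ≠ 0) (S : KSet n k) :
    Matrix.trace (samplesState t S) = 1 := by
  simp only [Matrix.trace, Matrix.diag_apply, samplesState_apply]
  exact sum_samples_mul_self hk t S

lemma samplesState_mul_self {n k t : ℕ} (hk : k ≠ 0) (S : KSet n k) :
    samplesState t S * samplesState t S = samplesState t S := by
  ext u v
  simp only [Matrix.mul_apply, samplesState_apply]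
  rw [← mul_one (samples t S u * samples t S v), ← sum_samples_mul_self hk t S, Finset.mul_sum]
  exact Finset.sum_congr rfl fun w _ => by ring

lemma one_sub_samplesState_posSemidef {n k t : ℕ} (hk : k ≠ 0) (S : KSet n k) :
    (1 - samplesState t S).PosSemidef := by
  have h : 1 - samplesState t S = (1 - samplesState t S).conjTranspose * (1 - samplesState t S) := by
    rw [Matrix.conjTranspose_sub, Matrix.conjTranspose_one, (samplesState_posSemidef S).1,
      mul_sub, sub_mul, sub_mul, samplesState_mul_self hk]
    simp
  rw [h]
  exact Matrix.posSemidef_conjTranspose_mul_self _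

lemma samplesState_add {n k t r : ℕ} (S : KSet n k) :
    samplesState (t + r) S = (samplesState t S ⊗ₖ samplesState r S).submatrix
      (Fin.appendEquiv t r).symm (Fin.appendEquiv t r).symm := by
  have h : ∀ u, samples (t + r) S u = samples t S ((Fin.appendEquiv t r).symm u).1
      * samples r S ((Fin.appendEquiv t r).symm u).2 := by
    intro u
    simp [samples, Fin.prod_univ_add, Fin.appendEquiv]
  ext u v
  rw [samplesState_apply, Matrix.submatrix_apply, Matrix.kroneckerMap_apply, samplesState_apply,
    samplesState_apply, h, h]
  ring

lemma trace_submatrix_equiv {ι κ : Type*} [Fintype ι] [Fintype κ] (A : Matrix ι ι ℂ) (e : κ ≃ ι) :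
    (A.submatrix e e).trace = A.trace := by
  simp only [Matrix.trace, Matrix.diag_apply, Matrix.submatrix_apply]
  exact e.sum_comp fun i => A i i

namespace Learner

variable {n k t : ℕ}

lemma outputProb_nonneg (L : Learner n k t) (S F : KSet n k) : 0 ≤ L.outputProb S F := by
  rw [outputProb, samplesState, Matrix.mul_vecMulVec, Matrix.trace_vecMulVec, dotProduct_comm]
  exact (Complex.le_def.1 ((L.posSemidef F).dotProduct_mulVec_nonneg (samples t S))).1

lemma sum_outputProb (hk : k ≠ 0) (L : Learner n k t) (S : KSet n k) :
    ∑ F, L.outputProb S F = 1 := by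
  simp only [outputProb]
  rw [← Complex.re_sum, ← Matrix.trace_sum, ← Matrix.sum_mul, L.sum_eq_one, one_mul,
    trace_samplesState hk, Complex.one_re]

lemma successProb_eq (L : Learner n k t) :
    L.successProb = (∑ S, L.outputProb S S) / n.choose k := by
  rw [successProb, Finset.sum_div]
  refine Finset.sum_congr rfl fun S _ => ?_
  rw [jointProb, uniformSet]
  ring

/-- The learner that checks the output of `L` on `r` additional samples, and replaces it by a
uniformly random set if the check fails. -/
def verify (hk : k ≠ 0) (hkn : k ≤ n) (L : Learner n k t) (r : ℕ) : Learner n k (t + r) where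
  effect F := (L.effect F ⊗ₖ samplesState r F + ((1 / (n.choose k) : ℝ) : ℂ) •
      ∑ G, L.effect G ⊗ₖ (1 - samplesState r G)).submatrix
        (Fin.appendEquiv t r).symm (Fin.appendEquiv t r).symm
  posSemidef F := by
    rw [Matrix.posSemidef_submatrix_equiv]
    refine ((L.posSemidef F).kronecker (samplesState_posSemidef F)).add
      (Matrix.PosSemidef.smul (Matrix.posSemidef_sum _ fun G _ =>
        (L.posSemidef G).kronecker (one_sub_samplesState_posSemidef hk G)) ?_)
    have : (0 : ℝ) ≤ 1 / (n.choose k) := by positivity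
    exact_mod_cast this
  sum_eq_one := by
    have hN : (n.choose k : ℂ) ≠ 0 := by exact_mod_cast (Nat.choose_pos hkn).ne'
    have h1 : ∑ F : KSet n k, (L.effect F ⊗ₖ samplesState r F + ((1 / (n.choose k) : ℝ) : ℂ) •
        ∑ G, L.effect G ⊗ₖ (1 - samplesState r G)) = 1 := by
      rw [Finset.sum_add_distrib, Finset.sum_const, Finset.card_univ, card_KSet,
        ← Nat.cast_smul_eq_nsmul ℂ, smul_smul]
      push_cast
      rw [mul_one_div_cancel hN, one_smul, ← Finset.sum_add_distrib]
      simp_rw [← Matrix.kronecker_add, add_sub_cancel]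
      rw [← Matrix.one_kronecker_one, ← L.sum_eq_one]
      ext ⟨a, b⟩ ⟨c, d⟩
      simp [Matrix.sum_apply, Matrix.kroneckerMap_apply, Finset.sum_mul]
    ext u v
    have h2 := congrFun (congrFun h1 ((Fin.appendEquiv t r).symm u)) ((Fin.appendEquiv t r).symm v)
    rw [Matrix.sum_apply] at h2 ⊢
    simp only [Matrix.submatrix_apply]
    rw [h2]
    simp only [Matrix.one_apply, EmbeddingLike.apply_eq_iff_eq]

/-- Trace is multiplicative on tensor products, and the check of G on samples of S passes with
probability (|S ∩ G|/k)^(2r). The second term is the total rejection probability, shared evenly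
among all sets. -/
lemma outputProb_verify (hk : k ≠ 0) (hkn : k ≤ n) (L : Learner n k t) (r : ℕ) (S F : KSet n k) :
    (L.verify hk hkn r).outputProb S F
      = L.outputProb S F * (((S.1 ∩ F.1).card / k : ℝ) ^ r) ^ 2 + 1 / (n.choose k) *
        ∑ G, L.outputProb S G * (1 - (((S.1 ∩ G.1).card / k : ℝ) ^ r) ^ 2) := by
  have h1 : ∀ G : KSet n k, Matrix.trace (samplesState r G * samplesState r S)
      = (((((S.1 ∩ G.1).card / k : ℝ) ^ r) ^ 2 : ℝ) : ℂ) := by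
    intro G
    rw [trace_samplesState_mul, Finset.inter_comm]
  have h2 : ∀ G : KSet n k, Matrix.trace ((1 - samplesState r G) * samplesState r S)
      = ((1 - (((S.1 ∩ G.1).card / k : ℝ) ^ r) ^ 2 : ℝ) : ℂ) := by
    intro G
    rw [sub_mul, one_mul, Matrix.trace_sub, h1, trace_samplesState hk]
    push_cast
    rfl
  rw [outputProb, samplesState_add, verify, Matrix.submatrix_mul_equiv, trace_submatrix_equiv,
    add_mul, Matrix.smul_mul, Matrix.sum_mul]
  simp_rw [← Matrix.mul_kronecker_mul]
  rw [Matrix.trace_add, Matrix.trace_smul, Matrix.trace_sum]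
  simp_rw [Matrix.trace_kronecker, h1, h2]
  rw [Complex.add_re, smul_eq_mul, Complex.re_ofReal_mul, Complex.re_sum]
  simp_rw [Complex.re_mul_ofReal]
  rfl

end Learner

/-- Concavity between c/(1-q) and 1/N, the first contribution being dropped as nonnegative: adding
noise of weight q keeps at least the fraction q of its entropy. -/
lemma mul_negMulLog_le {q c N : ℝ} (hq0 : 0 ≤ q) (hq1 : q ≤ 1) (hc0 : 0 ≤ c) (hc1 : c ≤ 1 - q)
    (hN : 1 ≤ N) : q * Real.negMulLog (1 / N) ≤ Real.negMulLog (c + 1 / N * q) := by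
  have hN0 : (0 : ℝ) ≤ 1 / N := by positivity
  rcases hq1.eq_or_lt with h | h
  · have : c = 0 := by linarith
    rw [h, this]
    simp
  · have hq : 0 < 1 - q := by linarith
    have := Real.concaveOn_negMulLog.2 (x := c / (1 - q)) (y := 1 / N)
      (Set.mem_Ici.2 (by positivity)) (Set.mem_Ici.2 hN0) hq.le hq0 (by ring)
    simp only [smul_eq_mul] at this
    rw [mul_div_cancel₀ _ hq.ne', mul_comm q (1 / N)] at this
    have h2 : 0 ≤ Real.negMulLog (c / (1 - q)) :=
      Real.negMulLog_nonneg (by positivity) ((div_le_one hq).2 hc1)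
    have h3 := mul_nonneg hq.le h2
    linarith

/-- A uniformly random set, passed through a channel that outputs an independent uniformly random
set with probability `q S`, conveys at most the remaining fraction of its entropy. -/
lemma mutualInfo_le_of_erasure {n k : ℕ} (hkn : k ≤ n) {c : KSet n k → KSet n k → ℝ}
    {q : KSet n k → ℝ} (hc : ∀ S F, 0 ≤ c S F) (hq : ∀ S, 0 ≤ q S)
    (hsum : ∀ S, ∑ F, c S F = 1 - q S) :
    mutualInfo (fun x : KSet n k × KSet n k =>
      uniformSet n k x.1 * (c x.1 x.2 + 1 / (n.choose k) * q x.1))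
      ≤ (1 - (∑ S, q S) / n.choose k) * Real.logb 2 (n.choose k) := by
  have hl2 : 0 < Real.log 2 := Real.log_pos (by norm_num)
  have hN1 : (1 : ℝ) ≤ n.choose k := by exact_mod_cast Nat.choose_pos hkn
  set N : ℝ := ((n.choose k : ℕ) : ℝ) with hN
  have hN0 : 0 < N := by linarith
  have hcard : (Fintype.card (KSet n k) : ℝ) = N := by rw [card_KSet]
  have hq1 : ∀ S, q S ≤ 1 := fun S => by
    have := Finset.sum_nonneg fun F (_ : F ∈ Finset.univ) => hc S F
    linarith [hsum S]
  have hb : ∀ S, ∑ F, (c S F + 1 / N * q S) = 1 := by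
    intro S
    rw [Finset.sum_add_distrib, hsum, Finset.sum_const, Finset.card_univ, nsmul_eq_mul, hcard]
    field_simp
    ring
  have hb0 : ∀ S F, 0 ≤ c S F + 1 / N * q S := fun S F =>
    add_nonneg (hc S F) (mul_nonneg (by positivity) (hq S))
  have hA : shannonEntropy (fun S : KSet n k =>
      ∑ F : KSet n k, uniformSet n k S * (c S F + 1 / N * q S)) = Real.logb 2 N := by
    rw [hN, ← shannonEntropy_uniformSet hkn]
    congr 1
    ext S
    rw [← Finset.mul_sum, hb, mul_one]
  have hF : shannonEntropy (fun F : KSet n k =>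
      ∑ S : KSet n k, uniformSet n k S * (c S F + 1 / N * q S)) ≤ Real.logb 2 N := by
    rw [shannonEntropy_eq_sum, Real.logb]
    refine div_le_div_of_nonneg_right ?_ hl2.le
    refine (sum_negMulLog_le_log_card (fun F => ?_) ?_).trans_eq (by rw [hcard])
    · refine Finset.sum_nonneg fun S _ => mul_nonneg ?_ (hb0 S F)
      rw [uniformSet]
      positivity
    · rw [Finset.sum_comm]
      simp_rw [← Finset.mul_sum, hb, mul_one, uniformSet]
      rw [Finset.sum_const, Finset.card_univ, nsmul_eq_mul, hcard, ← hN]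
      field_simp
  -- Given S, the output has conditional entropy at least q(S) log N. Averaged over S and added to
  -- H(A), this beats the trivial bound on H(F) by the erased fraction.
  have hAF : Real.logb 2 N + (∑ S, q S) / N * Real.logb 2 N ≤
      shannonEntropy (fun x : KSet n k × KSet n k =>
        uniformSet n k x.1 * (c x.1 x.2 + 1 / N * q x.1)) := by
    rw [shannonEntropy_eq_sum, Fintype.sum_prod_type, Real.logb, ← mul_div_assoc, ← add_div]
    refine div_le_div_of_nonneg_right ?_ hl2.le
    have key : ∀ S : KSet n k, 1 / N * Real.log N + q S / N * Real.log N ≤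
        ∑ F : KSet n k, Real.negMulLog (uniformSet n k S * (c S F + 1 / N * q S)) := by
      intro S
      simp_rw [Real.negMulLog_mul]
      rw [Finset.sum_add_distrib, ← Finset.sum_mul, hb, one_mul, ← Finset.mul_sum]
      have h1 : ∀ F, q S * Real.negMulLog (1 / N) ≤ Real.negMulLog (c S F + 1 / N * q S) := by
        intro F
        refine mul_negMulLog_le (hq S) (hq1 S) (hc S F) ?_ hN1
        rw [← hsum]
        exact Finset.single_le_sum (f := c S) (fun G _ => hc S G) (Finset.mem_univ F)
      have h2 := Finset.sum_le_sum fun F (_ : F ∈ Finset.univ) => h1 F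
      rw [Finset.sum_const, Finset.card_univ, nsmul_eq_mul, hcard] at h2
      have h3 : Real.negMulLog (1 / N) = 1 / N * Real.log N := by
        rw [Real.negMulLog, one_div, Real.log_inv]
        ring
      have h4 : uniformSet n k S = 1 / N := rfl
      rw [h4, h3]
      rw [h3] at h2
      have h5 := mul_le_mul_of_nonneg_left h2 (by positivity : 0 ≤ 1 / N)
      have h6 : 1 / N * (N * (q S * (1 / N * Real.log N))) = q S / N * Real.log N := by
        field_simp
      linarith
    refine le_trans (le_of_eq ?_) (Finset.sum_le_sum fun S _ => key S)
    rw [Finset.sum_add_distrib, Finset.sum_const, Finset.card_univ, nsmul_eq_mul, hcard,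
      ← Finset.sum_mul, ← Finset.sum_div]
    field_simp
  rw [mutualInfo]
  simp only
  linarith

/-- Distinct k-sets share at most k - 1 elements; the bound is the probability that a wrong output
survives the check. -/
lemma inter_card_div_pow_sq_le {n k r : ℕ} {c : ℝ} (hk : 0 < k) (hr : c * k ≤ r) {S F : KSet n k}
    (h : S ≠ F) : (((S.1 ∩ F.1).card / k : ℝ) ^ r) ^ 2 ≤ Real.exp (-2 * c) := by
  have hk' : (0 : ℝ) < k := by exact_mod_cast hk
  have h1 : (S.1 ∩ F.1).card + 1 ≤ k := by
    by_contra hc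
    have h2 : S.1 ∩ F.1 = S.1 := Finset.eq_of_subset_of_card_le Finset.inter_subset_left
      (by rw [S.2]; omega)
    have h3 : S.1 = F.1 := Finset.eq_of_subset_of_card_le (Finset.inter_eq_left.1 h2)
      (by rw [S.2, F.2])
    exact h (Subtype.ext h3)
  have h2 : ((S.1 ∩ F.1).card / k : ℝ) ≤ 1 - 1 / k := by
    rw [div_le_iff₀ hk', sub_mul, one_div_mul_cancel hk'.ne']
    have : ((S.1 ∩ F.1).card : ℝ) + 1 ≤ k := by exact_mod_cast h1
    linarith
  calc (((S.1 ∩ F.1).card / k : ℝ) ^ r) ^ 2 ≤ (Real.exp (-(r / k))) ^ 2 := by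
        refine pow_le_pow_left₀ (by positivity) ?_ 2
        exact (pow_le_pow_left₀ (by positivity) h2 r).trans (one_sub_inv_pow_le k r hk)
    _ = Real.exp (-2 * (r / k)) := by
        rw [← Real.exp_nat_mul]
        congr 1
        push_cast
        ring
    _ ≤ _ := by
        rw [Real.exp_le_exp]
        have : c ≤ r / k := by rwa [le_div_iff₀ hk']
        linarith

/-- Verification is an erasure channel: given S, it rejects with probability at least (1 - e^(-2c))
times the error probability of `L`. -/
lemma Learner.outputInfo_verify_le {n k t r : ℕ} (hk : k ≠ 0) (hkn : k ≤ n) (L : Learner n k t)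
    {c : ℝ} (hr : c * k ≤ r) :
    (L.verify hk hkn r).outputInfo
      ≤ (1 - (1 - Real.exp (-2 * c)) * (1 - L.successProb)) * Real.logb 2 (n.choose k) := by
  have hN1 : (1 : ℝ) ≤ n.choose k := by exact_mod_cast Nat.choose_pos hkn
  set N : ℝ := ((n.choose k : ℕ) : ℝ) with hN
  have hN0 : 0 < N := by linarith
  set w : KSet n k → KSet n k → ℝ := fun S F => (((S.1 ∩ F.1).card / k : ℝ) ^ r) ^ 2 with hw
  have hw1 : ∀ S F, w S F ≤ 1 := by
    intro S F
    refine pow_le_one₀ (by positivity) (pow_le_one₀ (by positivity) ?_)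
    rw [div_le_one (by positivity)]
    have := Finset.card_le_card (Finset.inter_subset_left (s₁ := S.1) (s₂ := F.1))
    rw [S.2] at this
    exact_mod_cast this
  set q : KSet n k → ℝ := fun S => ∑ G, L.outputProb S G * (1 - w S G) with hq
  have h1 := mutualInfo_le_of_erasure hkn (c := fun S F => L.outputProb S F * w S F) (q := q)
    (fun S F => mul_nonneg (L.outputProb_nonneg S F) (by positivity))
    (fun S => Finset.sum_nonneg fun G _ => mul_nonneg (L.outputProb_nonneg S G)
      (sub_nonneg.2 (hw1 S G)))
    (fun S => by
      simp only [hq, mul_sub, mul_one]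
      rw [Finset.sum_sub_distrib, L.sum_outputProb hk]
      ring)
  have h2 : (L.verify hk hkn r).jointProb = fun x : KSet n k × KSet n k =>
      uniformSet n k x.1 * (L.outputProb x.1 x.2 * w x.1 x.2 + 1 / (n.choose k) * q x.1) := by
    ext x
    rw [jointProb, outputProb_verify]
  rw [outputInfo, h2]
  refine h1.trans (mul_le_mul_of_nonneg_right ?_ (logb_choose_nonneg hkn))
  have h3 : ∀ S, (1 - Real.exp (-2 * c)) * (1 - L.outputProb S S) ≤ q S := by
    intro S
    have hs : 1 - L.outputProb S S = ∑ G ∈ Finset.univ.erase S, L.outputProb S G := by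
      rw [Finset.sum_erase_eq_sub (Finset.mem_univ S), L.sum_outputProb hk]
    rw [hs, Finset.mul_sum]
    refine le_trans (Finset.sum_le_sum (g := fun G => L.outputProb S G * (1 - w S G))
      fun G hG => ?_) (Finset.sum_le_sum_of_subset_of_nonneg (Finset.erase_subset S _)
        fun G _ _ => mul_nonneg (L.outputProb_nonneg S G) (sub_nonneg.2 (hw1 S G)))
    rw [mul_comm]
    refine mul_le_mul_of_nonneg_left ?_ (L.outputProb_nonneg S G)
    have := inter_card_div_pow_sq_le (Nat.pos_of_ne_zero hk) hr (Finset.ne_of_mem_erase hG).symm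
    linarith
  have h4 := Finset.sum_le_sum fun S (_ : S ∈ Finset.univ) => h3 S
  rw [← Finset.mul_sum, Finset.sum_sub_distrib, Finset.sum_const, Finset.card_univ, card_KSet,
    nsmul_eq_mul, mul_one] at h4
  have h5 := div_le_div_of_nonneg_right h4 hN0.le
  rw [L.successProb_eq]
  have h6 : (1 - Real.exp (-2 * c)) * (N - ∑ S, L.outputProb S S) / N
      = (1 - Real.exp (-2 * c)) * (1 - (∑ S, L.outputProb S S) / N) := by
    field_simp
  rw [h6] at h5
  linarith

/-- From any learner and `c k` additional samples, a learner at least as good of low output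
information. -/
lemma exists_learner_outputInfo_le {c : ℝ} {n k t' : ℕ} (L' : Learner n k t')
    (hk : 0 < k) (hkn : k ≤ n) : ∃ L : Learner n k (t' + ⌈c * k⌉₊),
      (∀ S, L'.outputProb S S ≤ L.outputProb S S) ∧ L'.successProb ≤ L.successProb ∧
      L.outputInfo ≤ (1 - (1 - Real.exp (-2 * c)) * (1 - L'.successProb))
          * Real.logb 2 (n.choose k) := by
  have h : ∀ S, L'.outputProb S S ≤ (L'.verify hk.ne' hkn ⌈c * k⌉₊).outputProb S S := by
    intro S
    have hk' : (k : ℝ) ≠ 0 := by exact_mod_cast hk.ne'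
    rw [Learner.outputProb_verify, Finset.inter_self, S.2, div_self hk']
    simp only [one_pow, mul_one, le_add_iff_nonneg_right]
    refine mul_nonneg (by positivity) (Finset.sum_nonneg fun G _ =>
      mul_nonneg (L'.outputProb_nonneg S G) (sub_nonneg.2 ?_))
    refine pow_le_one₀ (by positivity) (pow_le_one₀ (by positivity) ?_)
    rw [div_le_one (by positivity)]
    have := Finset.card_le_card (Finset.inter_subset_left (s₁ := S.1) (s₂ := G.1))
    rw [S.2] at this
    exact_mod_cast this
  refine ⟨L'.verify hk.ne' hkn ⌈c * k⌉₊, h, ?_,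
    L'.outputInfo_verify_le hk.ne' hkn (Nat.le_ceil _)⟩
  rw [Learner.successProb_eq, Learner.successProb_eq]
  exact div_le_div_of_nonneg_right (Finset.sum_le_sum fun S _ => h S) (Nat.cast_nonneg _)

/-! ### Learners of prescribed success probability and the limit of the information argument. -/

namespace Learner

variable {n k t : ℕ}

/-- The learner that measures the samples in the computational basis and outputs a function of the
result. -/
def ofFun (g : (Fin t → Fin n) → KSet n k) : Learner n k t where
  effect F := Matrix.diagonal fun u => if g u = F then 1 else 0
  posSemidef F := Matrix.PosSemidef.diagonal fun u => by
    dsimp only [Pi.zero_apply]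
    split_ifs <;> simp
  sum_eq_one := by
    ext u v
    rw [Matrix.sum_apply]
    by_cases h : u = v
    · subst h
      simp
    · simp [Matrix.diagonal_apply_ne _ h, Matrix.one_apply_ne h]

lemma outputProb_ofFun (g : (Fin t → Fin n) → KSet n k) (S F : KSet n k) :
    (ofFun g).outputProb S F = ∑ u, if g u = F then (samples t S u * samples t S u).re else 0 := by
  rw [outputProb, ofFun, Matrix.trace, Complex.re_sum]
  refine Finset.sum_congr rfl fun u _ => ?_
  rw [Matrix.diag_apply, Matrix.diagonal_mul, samplesState_apply]
  split_ifs <;> simp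

/-- The learner that uses the one or the other of two learners, at random. -/
def mix (L₀ L₁ : Learner n k t) (a b : ℝ) (ha : 0 ≤ a) (hb : 0 ≤ b) (hab : a + b = 1) :
    Learner n k t where
  effect F := (a : ℂ) • L₀.effect F + (b : ℂ) • L₁.effect F
  posSemidef F := ((L₀.posSemidef F).smul (by exact_mod_cast ha)).add
    ((L₁.posSemidef F).smul (by exact_mod_cast hb))
  sum_eq_one := by
    rw [Finset.sum_add_distrib, ← Finset.smul_sum, ← Finset.smul_sum, L₀.sum_eq_one,
      L₁.sum_eq_one, ← add_smul, ← Complex.ofReal_add, hab, Complex.ofReal_one, one_smul]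

lemma successProb_mix (L₀ L₁ : Learner n k t) (a b : ℝ) (ha : 0 ≤ a) (hb : 0 ≤ b)
    (hab : a + b = 1) :
    (L₀.mix L₁ a b ha hb hab).successProb = a * L₀.successProb + b * L₁.successProb := by
  simp only [successProb_eq]
  rw [← mul_div_assoc, ← mul_div_assoc, ← add_div, Finset.mul_sum, Finset.mul_sum,
    ← Finset.sum_add_distrib]
  congr 1
  refine Finset.sum_congr rfl fun S _ => ?_
  simp only [outputProb, mix, add_mul, Matrix.smul_mul, Matrix.trace_add, Matrix.trace_smul,
    smul_eq_mul, Complex.add_re, Complex.re_ofReal_mul]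

end Learner

lemma re_samples_mul_self_nonneg {n k t : ℕ} (S : KSet n k) (u : Fin t → Fin n) :
    0 ≤ (samples t S u * samples t S u).re := by
  have : samples t S u * samples t S u = samples t S u * (starRingEnd ℂ) (samples t S u) := by
    rw [star_samples]
  rw [this, Complex.mul_conj, Complex.ofReal_re]
  exact Complex.normSq_nonneg _

/-- Measured in the computational basis, the samples are independent uniform draws from S; the sum
is the probability of never drawing i. -/
lemma sum_samples_avoiding {n k t : ℕ} (hk : k ≠ 0) (S : KSet n k) {i : Fin n} (hi : i ∈ S.1) :
    ∑ u : Fin t → Fin n, (if ∀ j, u j ≠ i then (samples t S u * samples t S u).re else 0)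
      = (1 - 1 / (k : ℝ)) ^ t := by
  have hs : ∑ v, (if v ≠ i then sample S v * sample S v else 0) = ((1 - 1 / (k : ℝ) : ℝ) : ℂ) := by
    have h1 := sum_sample_mul_sample S S
    rw [Finset.inter_self, S.2, div_self (by exact_mod_cast hk : (k : ℝ) ≠ 0)] at h1
    rw [← Finset.sum_filter, Finset.filter_ne', Finset.sum_erase_eq_sub (Finset.mem_univ i), h1]
    simp only [sample, hi, if_true]
    rw [← Complex.ofReal_mul, div_mul_div_comm, Real.mul_self_sqrt (Nat.cast_nonneg _)]
    push_cast
    ring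
  have h2 := Fintype.sum_pow (fun v => if v ≠ i then sample S v * sample S v else 0) t
  rw [hs, ← Complex.ofReal_pow] at h2
  have h3 := congrArg Complex.re h2
  rw [Complex.ofReal_re, Complex.re_sum] at h3
  rw [h3]
  refine Finset.sum_congr rfl fun u _ => ?_
  by_cases h : ∀ j, u j ≠ i
  · rw [if_pos h]
    congr 1
    rw [samples, ← Finset.prod_mul_distrib]
    exact Finset.prod_congr rfl fun j _ => by rw [if_pos (h j)]
  · rw [if_neg h]
    push Not at h
    obtain ⟨j, hj⟩ := h
    rw [Finset.prod_eq_zero (Finset.mem_univ j), Complex.zero_re]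
    simp [hj]

lemma image_subset_of_samples_ne_zero {n k t : ℕ} {S : KSet n k} {u : Fin t → Fin n}
    (h : samples t S u ≠ 0) : Finset.univ.image u ⊆ S.1 := by
  intro v hv
  rw [Finset.mem_image] at hv
  obtain ⟨j, -, rfl⟩ := hv
  by_contra hc
  exact h (Finset.prod_eq_zero (Finset.mem_univ j) (by simp [sample, hc]))

/-- Collecting all coupons in the computational basis. -/
lemma exists_learner_outputProb_ge {n k : ℕ} (hk : k ≠ 0) (hkn : k ≤ n) (t : ℕ) :
    ∃ L : Learner n k t, ∀ S, 1 - k * (1 - 1 / (k : ℝ)) ^ t ≤ L.outputProb S S := by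
  classical
  obtain ⟨F₀⟩ := KSet_nonempty hkn
  refine ⟨Learner.ofFun fun u => if h : (Finset.univ.image u).card = k then ⟨_, h⟩ else F₀,
    fun S => ?_⟩
  rw [Learner.outputProb_ofFun]
  have h1 : ∑ u : Fin t → Fin n, (samples t S u * samples t S u).re = 1 := by
    rw [← Complex.re_sum, sum_samples_mul_self hk, Complex.one_re]
  -- Union bound over the coupons that may be missed; `F₀` serves only as the answer when the
  -- collection is incomplete.
  have h2 : ∑ u : Fin t → Fin n, ∑ i ∈ S.1,
      (if ∀ j, u j ≠ i then (samples t S u * samples t S u).re else 0)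
      = k * (1 - 1 / (k : ℝ)) ^ t := by
    rw [Finset.sum_comm, Finset.sum_congr rfl fun i hi => sum_samples_avoiding hk S hi,
      Finset.sum_const, S.2, nsmul_eq_mul]
  rw [← h2, ← h1, ← Finset.sum_sub_distrib]
  refine Finset.sum_le_sum fun u _ => ?_
  have hnn := re_samples_mul_self_nonneg S u
  have hsum : 0 ≤ ∑ i ∈ S.1, (if ∀ j, u j ≠ i then (samples t S u * samples t S u).re else 0) :=
    Finset.sum_nonneg fun i _ => by split_ifs <;> first | exact hnn | exact le_rfl
  by_cases h0 : samples t S u = 0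
  · simp [h0]
  have hsub := image_subset_of_samples_ne_zero h0
  by_cases he : Finset.univ.image u = S.1
  · have hc : (Finset.univ.image u).card = k := by rw [he, S.2]
    rw [dif_pos hc, if_pos (Subtype.ext he)]
    linarith
  · obtain ⟨i, hi, hi'⟩ : ∃ i ∈ S.1, i ∉ Finset.univ.image u := by
      by_contra hc
      push Not at hc
      exact he (Finset.Subset.antisymm hsub hc)
    have h3 : (samples t S u * samples t S u).re ≤
        ∑ i ∈ S.1, (if ∀ j, u j ≠ i then (samples t S u * samples t S u).re else 0) := by
      refine le_trans (le_of_eq ?_) (Finset.single_le_sum (f := fun i =>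
        (if ∀ j, u j ≠ i then (samples t S u * samples t S u).re else 0))
        (fun i _ => by split_ifs <;> first | exact hnn | exact le_rfl) hi)
      rw [if_pos]
      intro j hj
      exact hi' (Finset.mem_image.2 ⟨j, Finset.mem_univ _, hj⟩)
    have h4 : 0 ≤ (if (if h : (Finset.univ.image u).card = k then (⟨_, h⟩ : KSet n k) else F₀) = S
        then (samples t S u * samples t S u).re else 0) := by
      split_ifs <;> first | exact hnn | exact le_rfl
    linarith

/-- Success is affine under mixing, so it suffices to interpolate between a constant guess, which
succeeds with probability 1/C(n,k) ≤ 1/2, and coupon collection with many samples. -/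
lemma exists_learner_successProb_eq {n k : ℕ} (hk : k ≠ 0) (hkn : k < n) {δ : ℝ} (hδ : 0 < δ)
    (hδ' : δ ≤ 1 / 2) : ∃ (t : ℕ) (L : Learner n k t), L.successProb = 1 - δ := by
  have hk' : (0 : ℝ) < k := by exact_mod_cast Nat.pos_of_ne_zero hk
  have hk1 : (1 : ℝ) ≤ k := by exact_mod_cast Nat.pos_of_ne_zero hk
  have hN2 : (2 : ℝ) ≤ n.choose k := by
    have h1 : 2 ≤ n.choose k := by
      obtain ⟨k, rfl⟩ : ∃ j, k = j + 1 := ⟨k - 1, by omega⟩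
      obtain ⟨n, rfl⟩ : ∃ j, n = j + 1 := ⟨n - 1, by omega⟩
      rw [Nat.choose_succ_succ']
      have h2 := Nat.choose_pos (by omega : k ≤ n)
      have h3 := Nat.choose_pos (by omega : k + 1 ≤ n)
      omega
    exact_mod_cast h1
  obtain ⟨t, ht⟩ := exists_pow_lt_of_lt_one (div_pos hδ hk')
    (sub_lt_self 1 (one_div_pos.2 hk'))
  obtain ⟨L₁, hL₁⟩ := exists_learner_outputProb_ge hk hkn.le t
  obtain ⟨F₀⟩ := KSet_nonempty hkn.le
  set L₀ : Learner n k t := Learner.ofFun fun _ => F₀ with hL₀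
  have h0 : L₀.successProb ≤ 1 - δ := by
    have h1 : ∀ S, L₀.outputProb S S = if F₀ = S then 1 else 0 := by
      intro S
      rw [hL₀, Learner.outputProb_ofFun]
      split_ifs with h
      · rw [← Complex.re_sum, sum_samples_mul_self hk, Complex.one_re]
      · simp
    rw [Learner.successProb_eq]
    simp_rw [h1]
    rw [Finset.sum_ite_eq, if_pos (Finset.mem_univ _)]
    have := one_div_le_one_div_of_le (by norm_num) hN2
    linarith
  have h1 : 1 - δ ≤ L₁.successProb := by
    rw [Learner.successProb_eq, le_div_iff₀ (by linarith)]
    have h2 : ∀ S, 1 - δ ≤ L₁.outputProb S S := by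
      intro S
      refine le_trans ?_ (hL₁ S)
      rw [lt_div_iff₀ hk'] at ht
      linarith
    have := Finset.sum_le_sum fun S (_ : S ∈ Finset.univ) => h2 S
    rw [Finset.sum_const, Finset.card_univ, card_KSet, nsmul_eq_mul] at this
    linarith
  have hseg : 1 - δ ∈ segment ℝ L₀.successProb L₁.successProb := by
    rw [segment_eq_Icc (h0.trans h1)]
    exact ⟨h0, h1⟩
  obtain ⟨a, b, ha, hb, hab, h⟩ := hseg
  exact ⟨t, L₀.mix L₁ a b ha hb hab, by rw [Learner.successProb_mix]; simpa using h⟩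

/-- A verified learner forces β ≤ (1 - c₀δ) log C(n,m), while the Holevo information at t = ⌈κn⌉ is
already at least this. So T ≤ ⌈κn⌉, and κ + 1 absorbs the rounding. -/
lemma infoArgument_bound {δ : ℝ} (hδ : 0 < δ) (hδ' : δ ≤ 1 / 4) :
    ∃ κ : ℝ, 0 < κ ∧ ∃ η : ℝ, 0 < η ∧ ∀ n m T : ℕ, 0 < m → (m : ℝ) ≤ η * n →
      InfoArgumentYields n (n - m) δ T → (T : ℝ) ≤ κ * n := by
  set c₀ := 1 - Real.exp (-2 * 1) with hc₀
  have hc : 0 < c₀ := by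
    rw [hc₀, sub_pos, Real.exp_lt_one_iff]
    norm_num
  obtain ⟨κ, hκ, h⟩ := holevo_near_maximal (c₀ * δ) (by positivity)
  obtain ⟨η, hη, hη', h⟩ := h κ le_rfl
  refine ⟨κ + 1, by positivity, η, hη, fun n m T hm hmn hI => ?_⟩
  by_contra hT
  push Not at hT
  have hm' : (0 : ℝ) < m := by exact_mod_cast hm
  have h10 : 10 * m ≤ n := ten_mul_le hη' hmn
  have hn1 : (1 : ℝ) ≤ n := by exact_mod_cast (by omega : 1 ≤ n)
  have hk : n - m ≠ 0 := by omega
  obtain ⟨β, hβ, hI⟩ := hI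
  have ht : ⌈κ * n⌉₊ < T := by
    have := Nat.ceil_lt_add_one (by positivity : 0 ≤ κ * n)
    have : (⌈κ * n⌉₊ : ℝ) < T := by linarith
    exact_mod_cast this
  have h1 := hI _ ht
  rw [qMutualInfo_stateAB hk (by omega)] at h1
  obtain ⟨t', L', hL'⟩ := exists_learner_successProb_eq (n := n) hk (by omega) hδ (by linarith)
  obtain ⟨L, -, hL1, hL2⟩ := exists_learner_outputInfo_le (c := 1) L' (by omega) (by omega)
  have h2 := hβ _ L (by rw [← hL']; exact hL1)
  have h3 := h n m hm hmn
  rw [hL', sub_sub_cancel, Nat.choose_symm (by omega)] at hL2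
  linarith

/-! ### Fourier analysis of state identification on the cube. -/

section Cube

variable {L : ℕ}

/-- The characters of the cube `{0, 1}^L`. -/
def cubeChar (T x : Fin L → Bool) : ℝ := ∏ i, if T i && x i then -1 else 1

/-- Flip the bit `i`. -/
def flipBit (i : Fin L) (x : Fin L → Bool) : Fin L → Bool := Function.update x i (!x i)

lemma cubeChar_mul_self (T x : Fin L → Bool) : cubeChar T x * cubeChar T x = 1 := by
  rw [cubeChar, ← Finset.prod_mul_distrib]
  exact Finset.prod_eq_one fun i _ => by split_ifs <;> norm_num

lemma sum_cubeChar (x y : Fin L → Bool) :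
    ∑ T, cubeChar T x * cubeChar T y = if x = y then (2 : ℝ) ^ L else 0 := by
  have h1 : ∀ T : Fin L → Bool, cubeChar T x * cubeChar T y
      = ∏ i, (if T i && x i then (-1 : ℝ) else 1) * (if T i && y i then (-1 : ℝ) else 1) :=
    fun T => by rw [cubeChar, cubeChar, ← Finset.prod_mul_distrib]
  simp_rw [h1]
  have h2 := (Finset.prod_univ_sum (fun _ : Fin L => (Finset.univ : Finset Bool))
    fun i b => (if b && x i then (-1 : ℝ) else 1) * (if b && y i then (-1 : ℝ) else 1)).symm
  rw [Fintype.piFinset_univ] at h2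
  rw [h2]
  have h3 : ∀ i, (∑ b : Bool, (if b && x i then (-1 : ℝ) else 1) *
      (if b && y i then (-1 : ℝ) else 1)) = if x i = y i then 2 else 0 := by
    intro i
    rw [Fintype.sum_bool]
    cases x i <;> cases y i <;> norm_num
  simp_rw [h3]
  split_ifs with h
  · simp [h]
  · obtain ⟨i, hi⟩ := Function.ne_iff.1 h
    exact Finset.prod_eq_zero (Finset.mem_univ i) (if_neg hi)

/-- The sign by which a flip of the bit `i` acts on the character `T`. -/
def bitSign (T : Fin L → Bool) (i : Fin L) : ℝ := if T i then -1 else 1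

lemma cubeChar_flipBit (T x : Fin L → Bool) (i : Fin L) :
    cubeChar T (flipBit i x) = bitSign T i * cubeChar T x := by
  have h : bitSign T i = ∏ j, if j = i then bitSign T i else 1 := by simp
  rw [h, cubeChar, cubeChar, ← Finset.prod_mul_distrib]
  refine Finset.prod_congr rfl fun j _ => ?_
  by_cases hj : j = i
  · subst hj
    simp only [flipBit, Function.update_self, bitSign, if_true]
    cases T j <;> cases x j <;> norm_num
  · simp [flipBit, hj]

lemma flipBit_flipBit (i : Fin L) (x : Fin L → Bool) : flipBit i (flipBit i x) = x := by
  simp [flipBit]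

lemma flipBit_flipBit_ne {i j : Fin L} (h : i ≠ j) (x : Fin L → Bool) :
    flipBit i (flipBit j x) ≠ x := by
  intro hx
  have := congrFun hx i
  simp [flipBit, Function.update_of_ne h] at this

/-- Sums of characters weighted by signs. -/
lemma sum_bitSign_mul_cubeChar (x y : Fin L → Bool) (i j : Fin L) :
    ∑ T, bitSign T i * bitSign T j * (cubeChar T x * cubeChar T y)
      = if flipBit i (flipBit j x) = y then (2 : ℝ) ^ L else 0 := by
  rw [← sum_cubeChar]
  refine Finset.sum_congr rfl fun T _ => ?_
  rw [cubeChar_flipBit, cubeChar_flipBit]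
  ring

/-- The second moment of a sum of L independent signs. The characters at the zero point equal 1 and
are inserted to make `sum_bitSign_mul_cubeChar` applicable. -/
lemma sum_sum_bitSign_sq :
    ∑ T : Fin L → Bool, (∑ i, bitSign T i) ^ 2 = L * (2 : ℝ) ^ L := by
  have h1 : ∀ T : Fin L → Bool, (∑ i, bitSign T i) ^ 2
      = ∑ i, ∑ j, bitSign T i * bitSign T j *
        (cubeChar T (fun _ => false) * cubeChar T fun _ => false) := by
    intro T
    rw [cubeChar_mul_self, sq, Finset.sum_mul_sum]
    simp
  simp_rw [h1]
  rw [Finset.sum_comm]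
  have h2 : ∀ i : Fin L, ∑ T : Fin L → Bool, ∑ j, bitSign T i * bitSign T j *
      (cubeChar T (fun _ => false) * cubeChar T fun _ => false) = (2 : ℝ) ^ L := by
    intro i
    rw [Finset.sum_comm]
    simp_rw [sum_bitSign_mul_cubeChar]
    rw [Finset.sum_eq_single i]
    · rw [if_pos (flipBit_flipBit _ _)]
    · intro j _ hj
      rw [if_neg (flipBit_flipBit_ne hj.symm _)]
    · simp
  simp_rw [h2]
  simp

/-- The quadratic form of a matrix. -/
def quadForm {ι : Type*} [Fintype ι] (E : Matrix ι ι ℂ) (w : ι → ℂ) : ℝ :=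
  (star w ⬝ᵥ E.mulVec w).re

lemma quadForm_conjTranspose_mul {ι κ : Type*} [Fintype ι] [Fintype κ] (B : Matrix κ ι ℂ)
    (w : ι → ℂ) : quadForm (B.conjTranspose * B) w = ∑ r, ‖B.mulVec w r‖ ^ 2 := by
  rw [quadForm, ← Matrix.mulVec_mulVec, Matrix.dotProduct_mulVec, ← Matrix.star_mulVec, dotProduct,
    Complex.re_sum]
  refine Finset.sum_congr rfl fun r _ => ?_
  rw [Pi.star_apply, mul_comm, Complex.star_def, Complex.mul_conj, Complex.ofReal_re,
    Complex.normSq_eq_norm_sq]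

/-- Triangle inequality and Cauchy–Schwarz with weights `c`. The signs `a` disappear, so when they
are characters the bound depends on the cube point only through `E`. -/
lemma quadForm_sum_le {ι σ : Type*} [Fintype ι] [DecidableEq ι] [Fintype σ] {E : Matrix ι ι ℂ}
    (hE : E.PosSemidef) (a c : σ → ℝ) (ha : ∀ T, a T * a T = 1) (hc : ∀ T, 0 < c T)
    (v : σ → ι → ℂ) :
    quadForm E (∑ T, (a T : ℂ) • v T) ≤ (∑ T, c T) * ∑ T, quadForm E (v T) / c T := by
  obtain ⟨B, rfl⟩ : ∃ B : Matrix ι ι ℂ, E = B.conjTranspose * B := by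
    open scoped MatrixOrder in
    obtain ⟨B, hB⟩ := CStarAlgebra.nonneg_iff_eq_star_mul_self.mp hE.nonneg
    exact ⟨B, hB⟩
  simp only [quadForm_conjTranspose_mul, Finset.sum_div]
  rw [Finset.sum_comm, Finset.mul_sum]
  refine Finset.sum_le_sum fun r _ => ?_
  have h1 : ‖B.mulVec (∑ T, (a T : ℂ) • v T) r‖ ≤ ∑ T, ‖B.mulVec (v T) r‖ := by
    rw [Matrix.mulVec_sum, Finset.sum_apply]
    refine (norm_sum_le _ _).trans (Finset.sum_le_sum fun T _ => ?_)
    rw [Matrix.mulVec_smul, Pi.smul_apply, norm_smul, Complex.norm_real, Real.norm_eq_abs]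
    have : |a T| = 1 := by
      rcases mul_self_eq_one_iff.1 (ha T) with h | h <;> rw [h] <;> norm_num
    rw [this, one_mul]
  refine (pow_le_pow_left₀ (norm_nonneg _) h1 2).trans ?_
  refine Finset.sum_sq_le_sum_mul_sum_of_sq_le_mul _ (fun T _ => (hc T).le)
    (fun T _ => div_nonneg (sq_nonneg _) (hc T).le) fun T _ => le_of_eq ?_
  rw [mul_div_cancel₀ _ (hc T).ne']

lemma sum_quadForm_le {ι σ : Type*} [Fintype ι] [DecidableEq ι] [Fintype σ]
    {E : σ → Matrix ι ι ℂ} (hE : (1 - ∑ x, E x).PosSemidef) (w : ι → ℂ) :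
    ∑ x, quadForm (E x) w ≤ (star w ⬝ᵥ w).re := by
  have h := (Complex.le_def.1 (hE.dotProduct_mulVec_nonneg w)).1
  rw [Matrix.sub_mulVec, Matrix.one_mulVec, dotProduct_sub, Complex.sub_re, Matrix.sum_mulVec,
    dotProduct_sum, Complex.re_sum] at h
  simp only [quadForm]
  simpa using h

/-- The Fourier coefficients of a family of vectors on the cube. -/
def cubeCoeff {ι : Type*} (ψ : (Fin L → Bool) → ι → ℂ) (T : Fin L → Bool) : ι → ℂ :=
  ∑ x, ((cubeChar T x / 2 ^ L : ℝ) : ℂ) • ψ x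

lemma sum_cubeChar_smul_cubeCoeff {ι : Type*} (ψ : (Fin L → Bool) → ι → ℂ) (x : Fin L → Bool) :
    ∑ T, (cubeChar T x : ℂ) • cubeCoeff ψ T = ψ x := by
  simp only [cubeCoeff, Finset.smul_sum, smul_smul]
  rw [Finset.sum_comm]
  simp_rw [← Finset.sum_smul, ← Complex.ofReal_mul, ← Complex.ofReal_sum, ← mul_div_assoc,
    ← Finset.sum_div, sum_cubeChar]
  rw [Finset.sum_eq_single x]
  · simp
  · intro y _ hy
    simp [hy.symm]
  · simp

lemma star_cubeCoeff_dotProduct {ι : Type*} [Fintype ι] (ψ : (Fin L → Bool) → ι → ℂ)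
    (T : Fin L → Bool) : (star (cubeCoeff ψ T) ⬝ᵥ cubeCoeff ψ T).re
      = ∑ x, ∑ y, cubeChar T x * cubeChar T y * ((star (ψ x) ⬝ᵥ ψ y).re / 4 ^ L) := by
  simp only [cubeCoeff, star_sum, star_smul, sum_dotProduct, dotProduct_sum, smul_dotProduct,
    dotProduct_smul, smul_eq_mul, Complex.re_sum, Complex.star_def, Complex.conj_ofReal,
    Complex.re_ofReal_mul]
  conv_rhs => rw [Finset.sum_comm]
  refine Finset.sum_congr rfl fun y _ => ?_
  rw [Finset.mul_sum]
  refine Finset.sum_congr rfl fun x _ => ?_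
  rw [show (4 : ℝ) ^ L = 2 ^ L * 2 ^ L by rw [← mul_pow]; norm_num]
  field_simp

/-- A multiplier that acts on characters as a shift of the argument turns moments of the Fourier
weights into average overlaps of shifted states. -/
lemma sum_mul_cubeCoeff {ι : Type*} [Fintype ι] (ψ : (Fin L → Bool) → ι → ℂ)
    {s : (Fin L → Bool) → ℝ} {φ : (Fin L → Bool) → Fin L → Bool}
    (h : ∀ T x, s T * cubeChar T x = cubeChar T (φ x)) :
    ∑ T, s T * (star (cubeCoeff ψ T) ⬝ᵥ cubeCoeff ψ T).re
      = (∑ x, (star (ψ x) ⬝ᵥ ψ (φ x)).re) / 2 ^ L := by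
  simp_rw [star_cubeCoeff_dotProduct, Finset.mul_sum]
  rw [Finset.sum_comm, Finset.sum_div]
  refine Finset.sum_congr rfl fun x _ => ?_
  rw [Finset.sum_comm]
  simp_rw [← mul_assoc, h, ← Finset.sum_mul, sum_cubeChar]
  rw [Finset.sum_eq_single (φ x)]
  · rw [if_pos rfl, show (4 : ℝ) ^ L = 2 ^ L * 2 ^ L by rw [← mul_pow]; norm_num]
    field_simp
  · intro y _ hy
    rw [if_neg hy.symm, zero_mul]
  · simp

/-- States indexed by a cube whose overlaps are at least those of product states cannot be
identified well. -/
lemma sum_quadForm_cube_le {ι : Type*} [Fintype ι] [DecidableEq ι] (hL : 0 < L)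
    (ψ : (Fin L → Bool) → ι → ℂ) {E : (Fin L → Bool) → Matrix ι ι ℂ}
    (hE : ∀ x, (E x).PosSemidef) (hE1 : (1 - ∑ x, E x).PosSemidef) {ω : ℝ} (hω : 0 < ω)
    (h0 : ∀ x, (star (ψ x) ⬝ᵥ ψ x).re = 1)
    (h1 : ∀ x i, (star (ψ x) ⬝ᵥ ψ (flipBit i x)).re = ω)
    (h2 : ∀ x i j, i ≠ j → (star (ψ x) ⬝ᵥ ψ (flipBit i (flipBit j x))).re ≤ ω ^ 2) :
    (∑ x, quadForm (E x) (ψ x)) / 2 ^ L ≤ 8 / (L * ω ^ 2) := by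
  have hL' : (0 : ℝ) < L := by exact_mod_cast hL
  have h2L : (0 : ℝ) < 2 ^ L := by positivity
  have hcard : (Fintype.card (Fin L → Bool) : ℝ) = 2 ^ L := by simp
  -- The Fourier weights `w` form a probability distribution. Under it `y` has mean z = Lω and
  -- variance at most L, whereas for uniform T it has mean 0 and second moment L.
  set w : (Fin L → Bool) → ℝ := fun T => (star (cubeCoeff ψ T) ⬝ᵥ cubeCoeff ψ T).re with hw
  set y : (Fin L → Bool) → ℝ := fun T => ∑ i, bitSign T i with hy
  set z : ℝ := L * ω with hz
  have hz0 : 0 < z := by positivity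
  have m0 : ∑ T, w T = 1 := by
    have := sum_mul_cubeCoeff ψ (s := fun _ => 1) (φ := id) fun T x => by simp
    simp only [one_mul, id, h0, Finset.sum_const, Finset.card_univ, nsmul_eq_mul, mul_one,
      hcard] at this
    rw [div_self h2L.ne'] at this
    exact this
  have m1 : ∑ T, w T * y T = z := by
    have h3 : ∀ i : Fin L, ∑ T, bitSign T i * w T = ω := by
      intro i
      have := sum_mul_cubeCoeff ψ (s := fun T => bitSign T i) (φ := flipBit i)
        fun T x => (cubeChar_flipBit T x i).symm
      simp only [h1, Finset.sum_const, Finset.card_univ, nsmul_eq_mul, hcard] at this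
      rw [mul_div_cancel_left₀ _ h2L.ne'] at this
      exact this
    simp only [hy, Finset.mul_sum]
    rw [Finset.sum_comm]
    simp_rw [mul_comm (w _), h3]
    simp [hz]
  have m2 : ∑ T, w T * y T ^ 2 ≤ L + z ^ 2 := by
    have h3 : ∀ i j : Fin L, ∑ T, bitSign T i * bitSign T j * w T
        ≤ (if i = j then 1 else 0) + ω ^ 2 := by
      intro i j
      have := sum_mul_cubeCoeff ψ (s := fun T => bitSign T i * bitSign T j)
        (φ := fun x => flipBit i (flipBit j x))
        fun T x => by rw [cubeChar_flipBit, cubeChar_flipBit, mul_assoc]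
      rw [this, div_le_iff₀ h2L, ← hcard, mul_comm, ← nsmul_eq_mul, ← Finset.card_univ]
      refine Finset.sum_le_card_nsmul _ _ _ fun x _ => ?_
      split_ifs with hij
      · rw [hij, flipBit_flipBit, h0]
        linarith [sq_nonneg ω]
      · rw [zero_add]
        exact h2 x i j hij
    have h4 : ∑ T, w T * y T ^ 2 = ∑ i, ∑ j, ∑ T, bitSign T i * bitSign T j * w T := by
      have : ∀ T, w T * y T ^ 2 = ∑ i, ∑ j, bitSign T i * bitSign T j * w T := by
        intro T
        simp only [hy]
        rw [sq, Finset.sum_mul_sum, mul_comm, Finset.sum_mul]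
        simp_rw [Finset.sum_mul]
      simp_rw [this]
      rw [Finset.sum_comm]
      exact Finset.sum_congr rfl fun i _ => Finset.sum_comm
    rw [h4]
    refine (Finset.sum_le_sum fun i _ => Finset.sum_le_sum fun j _ => h3 i j).trans (le_of_eq ?_)
    simp only [Finset.sum_add_distrib, Finset.sum_ite_eq, Finset.mem_univ, if_true,
      Finset.sum_const, Finset.card_univ, Fintype.card_fin, nsmul_eq_mul, mul_one]
    rw [hz]
    ring
  -- Weights concentrated where `y` is near z. They keep ∑ w/c at most L plus the variance, while ∑
  -- c is small because a uniform T rarely has `y` near z.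
  set c : (Fin L → Bool) → ℝ := fun T => 1 / (L + (y T - z) ^ 2) with hc
  have hc0 : ∀ T, 0 < c T := fun T => by positivity
  have sc : ∑ T, c T ≤ 2 ^ L * (4 / z ^ 2) := by
    have h3 : ∀ T, c T ≤ (2 + 2 / L * y T ^ 2) / z ^ 2 := by
      intro T
      simp only [hc]
      rw [div_le_div_iff₀ (by positivity) (by positivity)]
      have h5 : z ^ 2 ≤ 2 * y T ^ 2 + 2 * (y T - z) ^ 2 := by nlinarith [sq_nonneg (2 * y T - z)]
      have h6 : 2 * y T ^ 2 = 2 / L * y T ^ 2 * L := by field_simp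
      have h7 : 0 ≤ 2 / L * y T ^ 2 * (y T - z) ^ 2 := by positivity
      nlinarith
    refine (Finset.sum_le_sum fun T _ => h3 T).trans (le_of_eq ?_)
    rw [← Finset.sum_div, Finset.sum_add_distrib, ← Finset.mul_sum, sum_sum_bitSign_sq,
      Finset.sum_const, Finset.card_univ, nsmul_eq_mul, hcard]
    field_simp
    ring
  have sw : ∑ T, w T / c T ≤ 2 * L := by
    have h3 : ∀ T, w T / c T = (L + z ^ 2) * w T - 2 * z * (w T * y T) + w T * y T ^ 2 := by
      intro T
      simp only [hc]
      rw [div_div_eq_mul_div, div_one]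
      ring
    simp_rw [h3]
    rw [Finset.sum_add_distrib, Finset.sum_sub_distrib, ← Finset.mul_sum, ← Finset.mul_sum, m0, m1]
    nlinarith
  have hq : ∀ x T, 0 ≤ quadForm (E x) (cubeCoeff ψ T) := fun x T =>
    (Complex.le_def.1 ((hE x).dotProduct_mulVec_nonneg _)).1
  -- Once the characters are gone, the effects at all x act on the same coefficients and sum to at
  -- most the identity.
  have main : ∑ x, quadForm (E x) (ψ x) ≤ (∑ T, c T) * ∑ T, w T / c T := by
    have h3 : ∀ x, quadForm (E x) (ψ x)
        ≤ (∑ T, c T) * ∑ T, quadForm (E x) (cubeCoeff ψ T) / c T := by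
      intro x
      conv_lhs => rw [← sum_cubeChar_smul_cubeCoeff ψ x]
      exact quadForm_sum_le (hE x) _ c (fun T => cubeChar_mul_self T x) hc0 _
    refine (Finset.sum_le_sum fun x _ => h3 x).trans ?_
    rw [← Finset.mul_sum, Finset.sum_comm]
    refine mul_le_mul_of_nonneg_left (Finset.sum_le_sum fun T _ => ?_)
      (Finset.sum_nonneg fun T _ => (hc0 T).le)
    rw [← Finset.sum_div]
    exact div_le_div_of_nonneg_right (sum_quadForm_le hE1 _) (hc0 T).le
  have hw0 : 0 ≤ ∑ T, w T / c T := by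
    refine le_trans ?_ (Finset.sum_le_sum fun T _ => div_le_div_of_nonneg_right
      (sum_quadForm_le hE1 (cubeCoeff ψ T)) (hc0 T).le)
    exact Finset.sum_nonneg fun T _ => div_nonneg (Finset.sum_nonneg fun x _ => hq x T) (hc0 T).le
  rw [div_le_iff₀ h2L]
  refine main.trans ((mul_le_mul sc sw hw0 (by positivity)).trans (le_of_eq ?_))
  rw [hz]
  field_simp
  norm_num

end Cube

/-! ### Cubes of k-sets, averaging over permutations, and failure of identification. -/

section CubeSet

variable {L r n k : ℕ}

/-- The set that contains one element of each of `L` pairs, selected by `x`, and `r` further fixed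
elements. -/
def cubeSet (e : (Fin L × Bool) ⊕ Fin r ↪ Fin n) (x : Fin L → Bool) : Finset (Fin n) :=
  (Finset.univ.filter fun p => Sum.elim (fun ib => x ib.1 == ib.2) (fun _ => true) p = true).map e

lemma card_cubeSet_inter (e : (Fin L × Bool) ⊕ Fin r ↪ Fin n) (x y : Fin L → Bool) :
    (cubeSet e x ∩ cubeSet e y).card = (Finset.univ.filter fun i => x i = y i).card + r := by
  rw [cubeSet, cubeSet, ← Finset.map_inter, Finset.card_map, ← Finset.filter_and,
    Finset.card_filter, Fintype.sum_sum_type, Fintype.sum_prod_type, Finset.card_filter]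
  congr 1
  · refine Finset.sum_congr rfl fun i _ => ?_
    rw [Fintype.sum_bool]
    cases hx : x i <;> cases hy : y i <;> simp [hx, hy]
  · simp

lemma card_cubeSet (e : (Fin L × Bool) ⊕ Fin r ↪ Fin n) (x : Fin L → Bool) :
    (cubeSet e x).card = L + r := by
  rw [← Finset.inter_self (cubeSet e x), card_cubeSet_inter]
  simp

lemma card_filter_flipBit (i : Fin L) (x : Fin L → Bool) :
    (Finset.univ.filter fun l => x l = flipBit i x l).card + 1 = L := by
  have : (Finset.univ.filter fun l => x l = flipBit i x l) = Finset.univ.erase i := by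
    ext l
    rw [Finset.mem_filter, Finset.mem_erase]
    by_cases h : l = i
    · subst h
      simp [flipBit]
    · simp [flipBit, h]
  rw [this, Finset.card_erase_add_one (Finset.mem_univ i), Finset.card_univ, Fintype.card_fin]

lemma card_filter_flipBit_flipBit {i j : Fin L} (hij : i ≠ j) (x : Fin L → Bool) :
    (Finset.univ.filter fun l => x l = flipBit i (flipBit j x) l).card + 2 = L := by
  have : (Finset.univ.filter fun l => x l = flipBit i (flipBit j x) l)
      = (Finset.univ.erase j).erase i := by
    ext l
    rw [Finset.mem_filter, Finset.mem_erase, Finset.mem_erase]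
    by_cases h : l = i
    · subst h
      simp [flipBit, hij]
    · by_cases h' : l = j
      · subst h'
        simp [flipBit, h]
      · simp [flipBit, h, h']
  have h1 := Finset.card_erase_add_one (Finset.mem_erase.2 ⟨hij, Finset.mem_univ i⟩)
  have h2 := Finset.card_erase_add_one (Finset.mem_univ j)
  rw [Finset.card_univ, Fintype.card_fin] at h2
  rw [this]
  omega

/-- The action of a permutation on `k`-sets. -/
def permSet (π : Equiv.Perm (Fin n)) (S : KSet n k) : KSet n k :=
  ⟨S.1.map π.toEmbedding, by rw [Finset.card_map, S.2]⟩

lemma permSet_injective (π : Equiv.Perm (Fin n)) :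
    Function.Injective (permSet π : KSet n k → KSet n k) := fun _ _ h =>
  Subtype.ext (Finset.map_injective _ (congrArg Subtype.val h))

lemma card_permSet_inter (π : Equiv.Perm (Fin n)) (S T : KSet n k) :
    ((permSet π S).1 ∩ (permSet π T).1).card = (S.1 ∩ T.1).card := by
  rw [permSet, permSet, ← Finset.map_inter, Finset.card_map]

lemma exists_permSet_eq (S T : KSet n k) : ∃ τ, permSet τ S = T := by
  have e : {x // x ∈ S.1} ≃ {x // x ∈ T.1} := Finset.equivOfCardEq (by rw [S.2, T.2])
  refine ⟨e.extendSubtype, Subtype.ext (Finset.eq_of_subset_of_card_le ?_ ?_)⟩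
  · intro y hy
    obtain ⟨x, hx, rfl⟩ := Finset.mem_map.1 hy
    exact e.extendSubtype_mem x hx
  · rw [(permSet _ S).2, T.2]

/-- The average over all sets is at most the largest average over a family of sets and its images
under permutations. -/
lemma average_le_of_permSet {X : Type*} [Fintype X] [Nonempty X] (hkn : k ≤ n)
    (f : X → KSet n k) (a : KSet n k → ℝ) {B : ℝ}
    (h : ∀ π : Equiv.Perm (Fin n), (∑ x, a (permSet π (f x))) / Fintype.card X ≤ B) :
    (∑ S, a S) / n.choose k ≤ B := by
  have hN : (0 : ℝ) < n.choose k := by exact_mod_cast Nat.choose_pos hkn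
  have hX : (0 : ℝ) < Fintype.card X := by exact_mod_cast Fintype.card_pos
  have hP : (0 : ℝ) < Fintype.card (Equiv.Perm (Fin n)) := by exact_mod_cast Fintype.card_pos
  obtain ⟨S₀⟩ := KSet_nonempty hkn
  set C := ∑ π : Equiv.Perm (Fin n), a (permSet π S₀) with hC
  -- Permutations act transitively on k-sets, so the orbit sum does not depend on S.
  have hconst : ∀ S, ∑ π : Equiv.Perm (Fin n), a (permSet π S) = C := by
    intro S
    obtain ⟨τ, hτ⟩ := exists_permSet_eq S₀ S
    rw [hC, ← hτ, ← Equiv.sum_comp (Equiv.mulRight τ) fun π => a (permSet π S₀)]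
    refine Finset.sum_congr rfl fun π _ => congrArg a (Subtype.ext ?_)
    simp only [permSet, Equiv.coe_mulRight, Finset.map_map]
    rfl
  have h1 : n.choose k * C = Fintype.card (Equiv.Perm (Fin n)) * ∑ S, a S := by
    have h2 : ∑ S : KSet n k, ∑ π : Equiv.Perm (Fin n), a (permSet π S) = n.choose k * C := by
      simp_rw [hconst]
      rw [Finset.sum_const, Finset.card_univ, card_KSet, nsmul_eq_mul]
    rw [← h2, Finset.sum_comm]
    have h3 : ∀ π : Equiv.Perm (Fin n), ∑ S : KSet n k, a (permSet π S) = ∑ S, a S := fun π =>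
      (Finite.injective_iff_bijective.1 (permSet_injective π)).sum_comp a
    simp_rw [h3]
    rw [Finset.sum_const, Finset.card_univ, nsmul_eq_mul]
  have h2 : Fintype.card X * C ≤ Fintype.card (Equiv.Perm (Fin n)) * (Fintype.card X * B) := by
    have h3 : ∑ π : Equiv.Perm (Fin n), ∑ x, a (permSet π (f x)) = Fintype.card X * C := by
      rw [Finset.sum_comm]
      simp_rw [hconst]
      rw [Finset.sum_const, Finset.card_univ, nsmul_eq_mul]
    rw [← h3]
    refine (Finset.sum_le_card_nsmul _ _ (Fintype.card X * B) fun π _ => ?_).trans_eq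
      (by rw [Finset.card_univ, nsmul_eq_mul])
    have := h π
    rw [div_le_iff₀ hX] at this
    linarith
  rw [div_le_iff₀ hN]
  have h3 : Fintype.card X * (n.choose k * C)
      ≤ n.choose k * (Fintype.card (Equiv.Perm (Fin n)) * (Fintype.card X * B)) := by
    have := mul_le_mul_of_nonneg_left h2 hN.le
    linarith
  rw [h1] at h3
  refine le_of_mul_le_mul_left ?_ (mul_pos hX hP)
  linarith

end CubeSet

lemma Learner.one_sub_sum_effect_posSemidef {X : Type*} [Fintype X] {n k t : ℕ}
    (A : Learner n k t) {g : X → KSet n k} (hg : Function.Injective g) :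
    (1 - ∑ x, A.effect (g x)).PosSemidef := by
  classical
  have h : 1 - ∑ x, A.effect (g x) = ∑ F ∈ (Finset.univ.image g)ᶜ, A.effect F := by
    rw [← A.sum_eq_one, ← Finset.sum_add_sum_compl (Finset.univ.image g),
      Finset.sum_image fun a _ b _ hab => hg hab]
    abel
  rw [h]
  exact Matrix.posSemidef_sum _ fun F _ => A.posSemidef F

lemma Learner.outputProb_eq_quadForm {n k t : ℕ} (A : Learner n k t) (S F : KSet n k) :
    A.outputProb S F = quadForm (A.effect F) (samples t S) := by
  rw [outputProb, samplesState, Matrix.mul_vecMulVec, Matrix.trace_vecMulVec, dotProduct_comm]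
  rfl

lemma star_samples_dotProduct {n k t : ℕ} (S T : KSet n k) :
    (star (samples t S) ⬝ᵥ samples t T).re = ((S.1 ∩ T.1).card / k : ℝ) ^ t := by
  rw [← Complex.ofReal_re (((S.1 ∩ T.1).card / k : ℝ) ^ t), ← sum_samples_mul_samples, dotProduct]
  congr 1
  refine Finset.sum_congr rfl fun u _ => ?_
  rw [Pi.star_apply, Complex.star_def, star_samples]

/-- The cube bound for every permuted copy of a family of 2^L sets; the L pairs and k - L fixed
elements occupy k + L points. -/
lemma Learner.successProb_le {n k t L : ℕ} (hL : 0 < L) (hLk : L ≤ k) (hk2 : 2 ≤ k)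
    (hkn : k + L ≤ n) (A : Learner n k t) :
    A.successProb ≤ 8 / (L * ((1 - 1 / (k : ℝ)) ^ t) ^ 2) := by
  obtain ⟨e⟩ : Nonempty ((Fin L × Bool) ⊕ Fin (k - L) ↪ Fin n) := by
    apply Function.Embedding.nonempty_of_card_le
    simp only [Fintype.card_sum, Fintype.card_prod, Fintype.card_fin, Fintype.card_bool]
    omega
  have hk' : (2 : ℝ) ≤ k := by exact_mod_cast hk2
  have hk0 : (0 : ℝ) < k := by linarith
  have hk1 : (0 : ℝ) < 1 - 1 / k := by
    rw [sub_pos, div_lt_one hk0]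
    linarith
  set f : (Fin L → Bool) → KSet n k := fun x =>
    ⟨cubeSet e x, by rw [card_cubeSet]; omega⟩ with hf
  have hfi : Function.Injective f := by
    intro x y hxy
    have h1 : cubeSet e x = cubeSet e y := congrArg Subtype.val hxy
    have h2 := card_cubeSet_inter e x y
    rw [← h1, Finset.inter_self, card_cubeSet] at h2
    have h3 : (Finset.univ.filter fun i => x i = y i) = Finset.univ :=
      Finset.eq_univ_of_card _ (by rw [Fintype.card_fin]; omega)
    ext1 i
    have := h3 ▸ Finset.mem_univ i
    exact (Finset.mem_filter.1 this).2
  rw [successProb_eq]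
  refine average_le_of_permSet (by omega) f (fun S => A.outputProb S S) fun π => ?_
  simp only [outputProb_eq_quadForm]
  rw [show (Fintype.card (Fin L → Bool) : ℝ) = 2 ^ L by simp]
  refine sum_quadForm_cube_le hL (fun x => samples t (permSet π (f x)))
    (fun x => A.posSemidef _) (A.one_sub_sum_effect_posSemidef ((permSet_injective π).comp hfi))
    (pow_pos hk1 t) (fun x => ?_) (fun x i => ?_) fun x i j hij => ?_
  · rw [star_samples_dotProduct, Finset.inter_self, (permSet π (f x)).2, div_self hk0.ne', one_pow]
  · rw [star_samples_dotProduct, card_permSet_inter, card_cubeSet_inter]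
    congr 1
    have h1 : ((Finset.univ.filter fun l => x l = flipBit i x l).card + (k - L)) + 1 = k := by
      have := card_filter_flipBit i x
      omega
    have h2 : (((Finset.univ.filter fun l => x l = flipBit i x l).card + (k - L) : ℕ) : ℝ) + 1
        = k := by exact_mod_cast h1
    rw [div_eq_iff hk0.ne', sub_mul, one_div_mul_cancel hk0.ne']
    linarith
  · rw [star_samples_dotProduct, card_permSet_inter, card_cubeSet_inter, ← pow_mul, mul_comm t 2,
      pow_mul]
    refine pow_le_pow_left₀ (by positivity) ?_ t
    have h1 : ((Finset.univ.filter fun l => x l = flipBit i (flipBit j x) l).card + (k - L)) + 2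
        = k := by
      have := card_filter_flipBit_flipBit hij x
      omega
    have h2 : (((Finset.univ.filter fun l => x l = flipBit i (flipBit j x) l).card + (k - L)
        : ℕ) : ℝ) + 2 = k := by exact_mod_cast h1
    rw [div_le_iff₀ hk0]
    -- Two flips give overlap (1 - 2/k)^t, and 1 - 2/k ≤ (1 - 1/k)².
    have h3 : (1 - 1 / (k : ℝ)) ^ 2 * k = k - 2 + 1 / k := by
      field_simp
      ring
    have : (0 : ℝ) ≤ 1 / k := by positivity
    linarith

/-- For k ≥ 2, 1 - 1/k ≥ 1/(1 + 2/k) ≥ e^(-2/k); so ω does not tend to 0 when t = O(k). -/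
lemma exp_le_one_sub_inv_pow {k t : ℕ} {κ : ℝ} (hk : 2 ≤ k) (ht : (t : ℝ) ≤ κ * k) :
    Real.exp (-2 * κ) ≤ (1 - 1 / (k : ℝ)) ^ t := by
  have hk' : (2 : ℝ) ≤ k := by exact_mod_cast hk
  have hk0 : (0 : ℝ) < k := by linarith
  have h1 : Real.exp (-(2 / k)) ≤ 1 - 1 / (k : ℝ) := by
    have h2 := Real.add_one_le_exp (2 / (k : ℝ))
    have h3 : 0 < (1 : ℝ) + 2 / k := by positivity
    calc Real.exp (-(2 / k)) ≤ 1 / (1 + 2 / k) := by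
          rw [Real.exp_neg, ← one_div]
          exact one_div_le_one_div_of_le h3 (by linarith)
      _ ≤ 1 - 1 / (k : ℝ) := by
          rw [div_le_iff₀ h3]
          have : (1 - 1 / (k : ℝ)) * (1 + 2 / k) = 1 + (k - 2) / k ^ 2 := by
            field_simp
            ring
          rw [this]
          have : 0 ≤ ((k : ℝ) - 2) / k ^ 2 := div_nonneg (by linarith) (by positivity)
          linarith
  calc Real.exp (-2 * κ) ≤ Real.exp (-(2 / k)) ^ t := by
        rw [← Real.exp_nat_mul, Real.exp_le_exp]
        have : (t : ℝ) * (2 / k) ≤ 2 * κ := by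
          rw [mul_div_assoc', div_le_iff₀ hk0]
          linarith
        linarith
    _ ≤ _ := pow_le_pow_left₀ (Real.exp_pos _).le h1 t

/-- With `O(k)` samples the set is not identified. -/
lemma successProb_small (κ p : ℝ) (hp : 0 < p) : ∃ M : ℕ, 2 ≤ M ∧ ∀ n k t : ℕ, M ≤ k →
    k + M ≤ n → (t : ℝ) ≤ κ * k → ∀ A : Learner n k t, A.successProb ≤ p := by
  set w := Real.exp (-2 * κ) with hw
  have hw0 : 0 < w := Real.exp_pos _
  refine ⟨⌈8 / (p * w ^ 2)⌉₊ + 2, by omega, fun n k t hMk hkn ht A => ?_⟩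
  set M := ⌈8 / (p * w ^ 2)⌉₊ + 2 with hM
  have hM1 : 8 / (p * w ^ 2) ≤ M := (Nat.le_ceil _).trans (by rw [hM]; push_cast; linarith)
  have hM0 : (0 : ℝ) < M := by exact_mod_cast (by omega : 0 < M)
  refine (A.successProb_le (L := M) (by omega) hMk (by omega) hkn).trans ?_
  have h1 := pow_le_pow_left₀ hw0.le (exp_le_one_sub_inv_pow (by omega : 2 ≤ k) ht) 2
  have h2 : (M : ℝ) * w ^ 2 ≤ M * ((1 - 1 / (k : ℝ)) ^ t) ^ 2 :=
    mul_le_mul_of_nonneg_left h1 hM0.le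
  have h3 : (0 : ℝ) < M * w ^ 2 := by positivity
  rw [div_le_iff₀ (h3.trans_le h2)]
  rw [div_le_iff₀ (by positivity)] at hM1
  have := mul_le_mul_of_nonneg_left h2 hp.le
  linarith

end CouponCollector

end

/-! ### Assembly of the theorem. -/

theorem mainTheorem6 :
    -- the Holevo information of the ensemble, and the maximum it can be
    (∀ (n m t : ℕ) (κ : ℝ), 2 ≤ m → (m : ℝ) ≤ n / 10 → 0 < κ → κ < n / m → (t : ℝ) = κ * n →
      CouponCollector.qMutualInfo (CouponCollector.stateAB n (n - m) t)
          = CouponCollector.vnEntropy (CouponCollector.stateB n (n - m) t) ∧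
      (1 - Real.exp (-κ) - κ * m / n) * Real.logb 2 (n.choose m) - 1
          ≤ CouponCollector.vnEntropy (CouponCollector.stateB n (n - m) t) ∧
      CouponCollector.vnEntropy (CouponCollector.stateB n (n - m) t)
          ≤ CouponCollector.shannonEntropy (CouponCollector.uniformSet n (n - m)) ∧
      CouponCollector.shannonEntropy (CouponCollector.uniformSet n (n - m))
          = Real.logb 2 (n.choose m)) ∧
    -- it is arbitrarily close to maximal when `κ` is a large constant
    (∀ ε : ℝ, 0 < ε → ∃ κ₀ : ℝ, 0 < κ₀ ∧ ∀ κ : ℝ, κ₀ ≤ κ → ∃ η : ℝ, 0 < η ∧ ∃ n₀ : ℕ,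
      ∀ n m : ℕ, n₀ ≤ n → 2 ≤ m → (m : ℝ) ≤ η * n →
        (1 - ε) * Real.logb 2 (n.choose m)
          ≤ CouponCollector.qMutualInfo (CouponCollector.stateAB n (n - m) ⌈κ * n⌉₊)) ∧
    -- learners of low output information, from any learner and `c k` additional samples
    (∀ (c δ : ℝ) (n k t' : ℕ) (L' : CouponCollector.Learner n k t'),
      0 < c → 0 < δ → δ ≤ 1 / 4 → 1 < k → k < n → L'.successProb = 1 - δ →
      ∃ L : CouponCollector.Learner n k (t' + ⌈c * k⌉₊),
        (∀ S, L'.outputProb S S ≤ L.outputProb S S) ∧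
        1 - δ ≤ L.successProb ∧
        L.outputInfo ≤ (1 - (1 - Real.exp (-2 * c)) * δ)
          * CouponCollector.shannonEntropy (CouponCollector.uniformSet n k)) ∧
    -- the gap for error `1 / 4` and `m = ⌊√n⌋`, with `Θ(n)` samples
    (∃ (γ c : ℝ) (n₀ : ℕ), 7 / 8 < γ ∧ 0 < c ∧ ∀ n : ℕ, n₀ ≤ n →
      γ * Real.logb 2 (n.choose n.sqrt)
        ≤ CouponCollector.qMutualInfo
            (CouponCollector.stateAB n (n - n.sqrt) (n / 2 + ⌈c * (n - n.sqrt : ℕ)⌉₊)) ∧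
      ∀ (t' : ℕ) (L' : CouponCollector.Learner n (n - n.sqrt) t'), L'.successProb = 3 / 4 →
        ∃ L : CouponCollector.Learner n (n - n.sqrt) (t' + ⌈c * (n - n.sqrt : ℕ)⌉₊),
          (∀ S, L'.outputProb S S ≤ L.outputProb S S) ∧
          3 / 4 ≤ L.successProb ∧
          L.outputInfo ≤ 7 / 8 * Real.logb 2 (n.choose n.sqrt)) ∧
    -- the information-theoretic argument yields no lower bound beyond linear in `n`
    (∀ δ : ℝ, 0 < δ → δ ≤ 1 / 4 → ∃ κ : ℝ, 0 < κ ∧ ∃ η : ℝ, 0 < η ∧ ∃ n₀ : ℕ,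
      ∀ n m T : ℕ, n₀ ≤ n → 2 ≤ m → (m : ℝ) ≤ η * n →
        CouponCollector.InfoArgumentYields n (n - m) δ T → (T : ℝ) ≤ κ * n) ∧
    -- with `O(k)` samples no measurement identifies the set with constant probability
    (∀ κ p : ℝ, 0 < κ → 0 < p → ∃ M : ℕ, ∀ n k t : ℕ, M ≤ k → k + M ≤ n → (t : ℝ) ≤ κ * k →
      ∀ L : CouponCollector.Learner n k t, L.successProb ≤ p) ∧
    -- ensembles of near-maximal entropy that are not well distinguishable
    (∀ ε : ℝ, 0 < ε → ∃ κ₀ : ℝ, 0 < κ₀ ∧ ∀ κ : ℝ, κ₀ ≤ κ → ∃ η : ℝ, 0 < η ∧ ∃ M : ℕ,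
      ∀ n m : ℕ, M ≤ m → (m : ℝ) ≤ η * n →
        (1 - ε) * CouponCollector.shannonEntropy (CouponCollector.uniformSet n (n - m))
          ≤ CouponCollector.vnEntropy (CouponCollector.stateB n (n - m) ⌈κ * n⌉₊) ∧
        ∀ L : CouponCollector.Learner n (n - m) ⌈κ * n⌉₊, L.successProb ≤ ε) := by
  refine ⟨?_, ?_, ?_, ?_, ?_, ?_, ?_⟩
  · intro n m t κ hm hmn hκ _ ht
    have h10 : 10 * m ≤ n := by
      have : (10 : ℝ) * m ≤ n := by linarith
      exact_mod_cast this
    refine ⟨CouponCollector.qMutualInfo_stateAB (by omega) (by omega), ?_, ?_, ?_⟩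
    -- The bound holds even without the subtracted 1.
    · have := CouponCollector.vnEntropy_stateB_ge_of_eq_mul (by omega) h10 hκ.le ht
      linarith
    · rw [CouponCollector.shannonEntropy_uniformSet (by omega)]
      exact CouponCollector.vnEntropy_stateB_le (by omega) (by omega)
    · rw [CouponCollector.shannonEntropy_uniformSet (by omega), Nat.choose_symm (by omega)]
  · intro ε hε
    obtain ⟨κ₀, hκ₀, h⟩ := CouponCollector.holevo_near_maximal ε hε
    refine ⟨κ₀, hκ₀, fun κ hκ => ?_⟩
    obtain ⟨η, hη, hη', h⟩ := h κ hκ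
    refine ⟨η, hη, 1, fun n m hn hm hmn => ?_⟩
    have h10 := CouponCollector.ten_mul_le hη' hmn
    rw [CouponCollector.qMutualInfo_stateAB (by omega) (by omega)]
    exact h n m (by omega) hmn
  · intro c δ n k t' L' _ _ _ hk hkn hL'
    obtain ⟨L, h1, h2, h3⟩ :=
      CouponCollector.exists_learner_outputInfo_le (c := c) L' (by omega) hkn.le
    refine ⟨L, h1, hL' ▸ h2, ?_⟩
    rw [CouponCollector.shannonEntropy_uniformSet hkn.le]
    rwa [hL', sub_sub_cancel] at h3
  · refine ⟨9 / 10, 10, 1000000, by norm_num, by norm_num, fun n hn => ?_⟩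
    have hs0 : 0 < n.sqrt := Nat.sqrt_pos.2 (by omega)
    have hs1 : n.sqrt < n := Nat.sqrt_lt_self (by omega)
    constructor
    · rw [CouponCollector.qMutualInfo_stateAB (by omega) (by omega)]
      exact CouponCollector.holevo_sqrt_ge n hn
    · intro t' L' hL'
      obtain ⟨L, h1, h2, h3⟩ :=
        CouponCollector.exists_learner_outputInfo_le (c := 10) L' (by omega) (by omega)
      refine ⟨L, h1, hL' ▸ h2, h3.trans ?_⟩
      rw [hL', Nat.choose_symm hs1.le]
      refine mul_le_mul_of_nonneg_right ?_ (CouponCollector.logb_choose_nonneg hs1.le)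
      -- With error 1/4 this crude bound already gives 1 - (1/2)(1/4) = 7/8.
      have h4 : Real.exp (-2 * 10) ≤ 1 / 2 := by
        have h5 := Real.add_one_le_exp (2 * 10)
        rw [neg_mul, Real.exp_neg, ← one_div]
        exact one_div_le_one_div_of_le (by norm_num) (by linarith)
      linarith
  · intro δ hδ hδ'
    obtain ⟨κ, hκ, η, hη, h⟩ := CouponCollector.infoArgument_bound hδ hδ'
    exact ⟨κ, hκ, η, hη, 0, fun n m T _ hm hmn hT => h n m T (by omega) hmn hT⟩
  · intro κ p _ hp
    obtain ⟨M, -, h⟩ := CouponCollector.successProb_small κ p hp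
    exact ⟨M, h⟩
  · intro ε hε
    obtain ⟨κ₀, hκ₀, h⟩ := CouponCollector.holevo_near_maximal ε hε
    refine ⟨κ₀, hκ₀, fun κ hκ => ?_⟩
    obtain ⟨η, hη, hη', h⟩ := h κ hκ
    -- ⌈κn⌉ ≤ (κ+1)n ≤ 2(κ+1)(n - m), because m ≤ n/10.
    obtain ⟨M, hM2, hM⟩ := CouponCollector.successProb_small (2 * (κ + 1)) ε hε
    refine ⟨η, hη, M, fun n m hMm hmn => ?_⟩
    have h10 := CouponCollector.ten_mul_le hη' hmn
    have hκ' : 0 < κ := hκ₀.trans_le hκ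
    constructor
    · rw [CouponCollector.shannonEntropy_uniformSet (by omega), Nat.choose_symm (by omega)]
      exact h n m (by omega) hmn
    · refine hM n (n - m) _ (by omega) (by omega) ?_
      have h1 := Nat.ceil_lt_add_one (by positivity : 0 ≤ κ * n)
      have h2 : (n : ℝ) ≤ 2 * (n - m : ℕ) := by exact_mod_cast (by omega : n ≤ 2 * (n - m))
      have h3 : (1 : ℝ) ≤ n := by exact_mod_cast (by omega : 1 ≤ n)
      have h4 := mul_le_mul_of_nonneg_left h2 (by positivity : 0 ≤ κ + 1)
      linarith
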